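/- Let $(\mathcal C,\mathbb E,\mathfrak s)$ be an extriangulated category (in the sense of Nakaoka and Palu) satisfying Condition (WIC): if $gf$ is an inflation then so is $f$, and if $gf$ is a deflation then so is $g$. Let $\xi$ be a proper class of $\mathbb E$-triangles, that is, a class of $\mathbb E$-triangles closed under isomorphisms, finite coproducts, base change and cobase change, containing the split $\mathbb E$-triangles, and saturated. Definitions. An object $P$ is $\xi$-projective if $0\to\mathcal C(P,A)\to\mathcal C(P,B)\to\mathcal C(P,C)\to 0$ is exact for every $\mathbb E$-triangle $A\to B\to C\dashrightarrow$ in $\xi$; $\xi$-injective objects are defined dually. Assume that $\mathcal C$ has enough $\xi$-projectives and enough $\xi$-injectives, i.e. for each object $A$ there are $\mathbb E$-triangles $K\to P\to A\dashrightarrow$ and $A\to I\to L\dashrightarrow$ in $\xi$ with $P$ $\xi$-projective and $I$ $\xi$-injective. One says $\xi\text{-}\mathrm{pd}\,A\le 0$ if $A$ is $\xi$-projective, and $\xi\text{-}\mathrm{pd}\,A\le n$ (for $n\ge 1$) if $A$ is $\xi$-projective or there is an $\mathbb E$-triangle $K\to P\to A\dashrightarrow$ in $\xi$ with $P$ $\xi$-projective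 and $\xi\text{-}\mathrm{pd}\,K\le n-1$; $\xi\text{-}\mathrm{id}$ is defined dually. An object is $\xi$-$\mathcal G$projective if it is one of the objects $K_n$ for some complex $(P_n,d_n)_{n\in\mathbb Z}$ of $\xi$-projective objects and $\mathbb E$-triangles $K_{n+1}\xrightarrow{g_n}P_n\xrightarrow{f_n}K_n\dashrightarrow$ in $\xi$ with $d_n=g_{n-1}f_n$ such that $0\to\mathcal C(K_n,Q)\to\mathcal C(P_n,Q)\to\mathcal C(K_{n+1},Q)\to0$ is exact for all $n$ and all $\xi$-projective $Q$; $\xi$-$\mathcal G$injective objects are defined dually. For an object $M$, consider complexes $\mathbf X=(\cdots\to X_1\to X_0)$ with $\mathbb E$-triangles $K_{i+1}\xrightarrow{g_i}X_i\xrightarrow{f_i}K_i\dashrightarrow$ in $\xi$ $(i\ge0)$, $K_0=M$, whose differentials are $d_i=g_{i-1}f_i$ $(i\ge 1)$. Such an $\mathbf X\to M$ is a $\xi$-projective resolution of $M$ if all $X_i$ are $\xi$-projective, and a $\xi$-$\mathcal G$projective resolution of $M$ if all $X_i$ are $\xi$-$\mathcal G$projective and $0\to\mathcal C(G,K_{i+1})\to\mathcal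 C(G,X_i)\to\mathcal C(G,K_i)\to0$ is exact for all $i$ and all $\xi$-$\mathcal G$projective $G$. $\xi$-injective and $\xi$-$\mathcal G$injective coresolutions $N\to\mathbf X$ are defined dually. Put $$\xi\mathrm{xt}^n_{\mathcal P(\xi)}(M,N)=H^n(\mathcal C(\mathbf P,N)),\qquad \xi\mathrm{xt}^n_{\mathcal I(\xi)}(M,N)=H^n(\mathcal C(M,\mathbf I)),$$ $$\xi\mathrm{xt}^n_{\mathcal{GP}(\xi)}(M,N)=H^n(\mathcal C(\mathbf G,N)),\qquad \xi\mathrm{xt}^n_{\mathcal{GI}(\xi)}(M,N)=H^n(\mathcal C(M,\mathbf E)),$$ where $\mathbf P\to M$, $N\to\mathbf I$, $\mathbf G\to M$, $N\to\mathbf E$ are, respectively, a $\xi$-projective resolution, a $\xi$-injective coresolution, a $\xi$-$\mathcal G$projective resolution and a $\xi$-$\mathcal G$injective coresolution; $\xi\mathrm{xt}^n_\xi(M,N)$ denotes the common value, up to isomorphism, of the first two groups. Proposition. Let $M,N$ be objects of $\mathcal C$. Then $M$ has a $\xi$-projective resolution and $N$ has a $\xi$-injective coresolution, and the following hold. (1)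 If $\xi\text{-}\mathrm{pd}\,M<\infty$, then $M$ has a $\xi$-$\mathcal G$projective resolution, and $\xi\mathrm{xt}^n_{\mathcal{GP}(\xi)}(M,N)\cong\xi\mathrm{xt}^n_\xi(M,N)$ for all $n\ge0$. (2) If $\xi\text{-}\mathrm{id}\,N<\infty$, then $N$ has a $\xi$-$\mathcal G$injective coresolution, and $\xi\mathrm{xt}^n_{\mathcal{GI}(\xi)}(M,N)\cong\xi\mathrm{xt}^n_\xi(M,N)$ for all $n\ge0$. Here the groups may be computed with any choice of resolutions and coresolutions, and $\xi\mathrm{xt}^n_\xi(M,N)$ may be read as either $\xi\mathrm{xt}^n_{\mathcal P(\xi)}(M,N)$ or $\xi\mathrm{xt}^n_{\mathcal I(\xi)}(M,N)$. -/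

import Mathlib

open CategoryTheory CategoryTheory.Limits Opposite

universe w v u

/-! ## Extriangulated categories -/

/-- The data and axioms making an additive category `C` into an extriangulated category
`(C, 𝔼, 𝔰)` in the sense of Nakaoka and Palu.  The realization `𝔰` is given by the predicate
`Realizes δ x y`, meaning that the sequence `A ⟶ B ⟶ D` given by `x`, `y` belongs to the
equivalence class `𝔰(δ)`. -/
structure Extriangulation (C : Type u) [Category.{v} C] [Preadditive C] [HasZeroObject C]
    [HasBinaryBiproducts C] where
  /-- the bifunctor `𝔼 : Cᵒᵖ × C → Ab`; an element of `(𝔼.obj (op D)).obj A` is an extension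
  of `D` by `A` -/
  𝔼 : Cᵒᵖ ⥤ C ⥤ AddCommGrpCat.{w}
  additive_left : 𝔼.Additive
  additive_right : ∀ D : Cᵒᵖ, (𝔼.obj D).Additive
  /-- `Realizes δ x y` : `𝔰(δ) = [A ⟶ B ⟶ D]` -/
  Realizes : ∀ ⦃A B D : C⦄, (𝔼.obj (op D)).obj A → (A ⟶ B) → (B ⟶ D) → Prop
  /-- `𝔰(δ)` is non-empty -/
  exists_realizes : ∀ ⦃A D : C⦄ (δ : (𝔼.obj (op D)).obj A),
    ∃ (B : C) (x : A ⟶ B) (y : B ⟶ D), Realizes δ x y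
  /-- `𝔰(δ)` is one equivalence class of sequences -/
  realizes_iff : ∀ ⦃A B B' D : C⦄ (δ : (𝔼.obj (op D)).obj A) (x : A ⟶ B) (y : B ⟶ D)
    (x' : A ⟶ B') (y' : B' ⟶ D), Realizes δ x y →
    (Realizes δ x' y' ↔ ∃ b : B ≅ B', x ≫ b.hom = x' ∧ b.hom ≫ y' = y)
  /-- every morphism of extensions is realized by a morphism of sequences -/
  realization : ∀ ⦃A B D A' B' D' : C⦄ (δ : (𝔼.obj (op D)).obj A)
    (δ' : (𝔼.obj (op D')).obj A') (x : A ⟶ B) (y : B ⟶ D) (x' : A' ⟶ B') (y' : B' ⟶ D'),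
    Realizes δ x y → Realizes δ' x' y' → ∀ (a : A ⟶ A') (d : D ⟶ D'),
    (𝔼.obj (op D)).map a δ = (𝔼.map d.op).app A' δ' →
    ∃ b : B ⟶ B', x ≫ b = a ≫ x' ∧ y ≫ d = b ≫ y'
  /-- the zero extension is realized by the split sequence -/
  realizes_zero : ∀ A D : C, Realizes (0 : (𝔼.obj (op D)).obj A)
    (biprod.inl : A ⟶ A ⊞ D) (biprod.snd : A ⊞ D ⟶ D)
  /-- `𝔰(δ ⊕ δ') = 𝔰(δ) ⊕ 𝔰(δ')` -/
  realizes_biprod : ∀ ⦃A B D A' B' D' : C⦄ (δ : (𝔼.obj (op D)).obj A)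
    (δ' : (𝔼.obj (op D')).obj A') (x : A ⟶ B) (y : B ⟶ D) (x' : A' ⟶ B') (y' : B' ⟶ D'),
    Realizes δ x y → Realizes δ' x' y' →
    Realizes
      ((𝔼.obj (op (D ⊞ D'))).map (biprod.inl : A ⟶ A ⊞ A')
          ((𝔼.map (biprod.fst : D ⊞ D' ⟶ D).op).app A δ) +
        (𝔼.obj (op (D ⊞ D'))).map (biprod.inr : A' ⟶ A ⊞ A')
          ((𝔼.map (biprod.snd : D ⊞ D' ⟶ D').op).app A' δ'))
      (biprod.map x x') (biprod.map y y')
  /-- axiom (ET3) -/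
  et3 : ∀ ⦃A B D A' B' D' : C⦄ (δ : (𝔼.obj (op D)).obj A)
    (δ' : (𝔼.obj (op D')).obj A') (x : A ⟶ B) (y : B ⟶ D) (x' : A' ⟶ B') (y' : B' ⟶ D'),
    Realizes δ x y → Realizes δ' x' y' → ∀ (a : A ⟶ A') (b : B ⟶ B'), x ≫ b = a ≫ x' →
    ∃ d : D ⟶ D', y ≫ d = b ≫ y' ∧ (𝔼.obj (op D)).map a δ = (𝔼.map d.op).app A' δ'
  /-- axiom (ET3)ᵒᵖ -/
  et3_op : ∀ ⦃A B D A' B' D' : C⦄ (δ : (𝔼.obj (op D)).obj A)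
    (δ' : (𝔼.obj (op D')).obj A') (x : A ⟶ B) (y : B ⟶ D) (x' : A' ⟶ B') (y' : B' ⟶ D'),
    Realizes δ x y → Realizes δ' x' y' → ∀ (b : B ⟶ B') (d : D ⟶ D'), y ≫ d = b ≫ y' →
    ∃ a : A ⟶ A', x ≫ b = a ≫ x' ∧ (𝔼.obj (op D)).map a δ = (𝔼.map d.op).app A' δ'
  /-- axiom (ET4) : composition of inflations -/
  et4 : ∀ ⦃A B D X F : C⦄ (δ : (𝔼.obj (op D)).obj A) (δ' : (𝔼.obj (op F)).obj B)
    (f : A ⟶ B) (f' : B ⟶ D) (g : B ⟶ X) (g' : X ⟶ F),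
    Realizes δ f f' → Realizes δ' g g' →
    ∃ (Z : C) (h' : X ⟶ Z) (d : D ⟶ Z) (e : Z ⟶ F) (δ'' : (𝔼.obj (op Z)).obj A),
      Realizes δ'' (f ≫ g) h' ∧ f' ≫ d = g ≫ h' ∧ h' ≫ e = g' ∧
      Realizes ((𝔼.obj (op F)).map f' δ') d e ∧
      (𝔼.map d.op).app A δ'' = δ ∧
      (𝔼.obj (op Z)).map f δ'' = (𝔼.map e.op).app B δ'
  /-- axiom (ET4)ᵒᵖ : composition of deflations -/
  et4_op : ∀ ⦃D A B F X : C⦄ (δ : (𝔼.obj (op B)).obj D) (δ' : (𝔼.obj (op X)).obj F)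
    (f' : D ⟶ A) (f : A ⟶ B) (g' : F ⟶ B) (g : B ⟶ X),
    Realizes δ f' f → Realizes δ' g' g →
    ∃ (Z : C) (h' : Z ⟶ A) (d : D ⟶ Z) (e : Z ⟶ F) (δ'' : (𝔼.obj (op X)).obj Z),
      Realizes δ'' h' (f ≫ g) ∧ d ≫ h' = f' ∧ h' ≫ f = e ≫ g' ∧
      Realizes ((𝔼.map g'.op).app D δ) d e ∧
      (𝔼.obj (op X)).map e δ'' = δ' ∧
      (𝔼.obj (op B)).map d δ = (𝔼.map g.op).app Z δ''

namespace Extriangulation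

section

variable {C : Type u} [Category.{v} C] [Preadditive C] [HasZeroObject C] [HasBinaryBiproducts C]

/-- The group `𝔼(D, A)` of extensions of `D` by `A`. -/
abbrev Ext (E : Extriangulation.{w} C) (D A : C) : Type w := (E.𝔼.obj (op D)).obj A

/-- `a_* δ` -/
abbrev push (E : Extriangulation.{w} C) {D A A' : C} (a : A ⟶ A') (δ : E.Ext D A) :
    E.Ext D A' := (E.𝔼.obj (op D)).map a δ

/-- `d^* δ` -/
abbrev pull (E : Extriangulation.{w} C) {D D' A : C} (d : D' ⟶ D) (δ : E.Ext D A) :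
    E.Ext D' A := (E.𝔼.map d.op).app A δ

/-- `δ ⊕ δ'` -/
noncomputable abbrev extSum (E : Extriangulation.{w} C) {D A D' A' : C} (δ : E.Ext D A) (δ' : E.Ext D' A') :
    E.Ext (D ⊞ D') (A ⊞ A') :=
  E.push biprod.inl (E.pull biprod.fst δ) + E.push biprod.inr (E.pull biprod.snd δ')

/-- `x` is an inflation. -/
def IsInflation (E : Extriangulation.{w} C) {A B : C} (x : A ⟶ B) : Prop :=
  ∃ (D : C) (y : B ⟶ D) (δ : E.Ext D A), E.Realizes δ x y

/-- `y` is a deflation. -/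
def IsDeflation (E : Extriangulation.{w} C) {B D : C} (y : B ⟶ D) : Prop :=
  ∃ (A : C) (x : A ⟶ B) (δ : E.Ext D A), E.Realizes δ x y

/-- Condition (WIC). -/
def WIC (E : Extriangulation.{w} C) : Prop :=
  (∀ ⦃A B D : C⦄ (f : A ⟶ B) (g : B ⟶ D), E.IsInflation (f ≫ g) → E.IsInflation f) ∧
  (∀ ⦃A B D : C⦄ (f : A ⟶ B) (g : B ⟶ D), E.IsDeflation (f ≫ g) → E.IsDeflation g)

/-! ## Proper classes of `𝔼`-triangles -/

/-- A proper class `ξ` of `𝔼`-triangles. `ξ.Mem x y δ` says that the `𝔼`-triangle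
`A ⟶ B ⟶ D ⇢` given by `x`, `y`, `δ` belongs to `ξ`. -/
structure ProperClass (E : Extriangulation.{w} C) where
  Mem : ∀ ⦃A B D : C⦄, (A ⟶ B) → (B ⟶ D) → E.Ext D A → Prop
  /-- the members of `ξ` are `𝔼`-triangles -/
  realizes : ∀ ⦃A B D : C⦄ (x : A ⟶ B) (y : B ⟶ D) (δ : E.Ext D A),
    Mem x y δ → E.Realizes δ x y
  /-- closed under isomorphisms of `𝔼`-triangles -/
  mem_of_iso : ∀ ⦃A B D A' B' D' : C⦄ (x : A ⟶ B) (y : B ⟶ D) (δ : E.Ext D A)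
    (x' : A' ⟶ B') (y' : B' ⟶ D') (δ' : E.Ext D' A'),
    Mem x y δ → E.Realizes δ' x' y' → ∀ (a : A ≅ A') (b : B ≅ B') (d : D ≅ D'),
    x ≫ b.hom = a.hom ≫ x' → y ≫ d.hom = b.hom ≫ y' → E.push a.hom δ = E.pull d.hom δ' →
    Mem x' y' δ'
  /-- closed under finite coproducts (the empty coproduct is covered by `mem_split`) -/
  mem_biprod : ∀ ⦃A B D A' B' D' : C⦄ (x : A ⟶ B) (y : B ⟶ D) (δ : E.Ext D A)
    (x' : A' ⟶ B') (y' : B' ⟶ D') (δ' : E.Ext D' A'),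
    Mem x y δ → Mem x' y' δ' → Mem (biprod.map x x') (biprod.map y y') (E.extSum δ δ')
  /-- contains the split `𝔼`-triangles -/
  mem_split : ∀ ⦃A B D : C⦄ (x : A ⟶ B) (y : B ⟶ D),
    E.Realizes (0 : E.Ext D A) x y → Mem x y (0 : E.Ext D A)
  /-- closed under base change -/
  base_change : ∀ ⦃A B D B' D' : C⦄ (x : A ⟶ B) (y : B ⟶ D) (δ : E.Ext D A) (d : D' ⟶ D)
    (x' : A ⟶ B') (y' : B' ⟶ D'),
    Mem x y δ → E.Realizes (E.pull d δ) x' y' → Mem x' y' (E.pull d δ)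
  /-- closed under cobase change -/
  cobase_change : ∀ ⦃A B D A' B' : C⦄ (x : A ⟶ B) (y : B ⟶ D) (δ : E.Ext D A) (a : A ⟶ A')
    (x' : A' ⟶ B') (y' : B' ⟶ D),
    Mem x y δ → E.Realizes (E.push a δ) x' y' → Mem x' y' (E.push a δ)
  /-- saturated -/
  saturated : ∀ ⦃A₁ B₁ A₂ B₂ D X : C⦄ (x₁ : A₁ ⟶ B₁) (y₁ : B₁ ⟶ D) (δ₁ : E.Ext D A₁)
    (x₂ : A₂ ⟶ B₂) (y₂ : B₂ ⟶ D) (δ₂ : E.Ext D A₂)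
    (m₁ : A₁ ⟶ X) (e₁ : X ⟶ B₂) (m₂ : A₂ ⟶ X) (e₂ : X ⟶ B₁),
    E.Realizes δ₁ x₁ y₁ → E.Realizes δ₂ x₂ y₂ →
    m₁ ≫ e₂ = x₁ → m₂ ≫ e₁ = x₂ → e₁ ≫ y₂ = e₂ ≫ y₁ →
    E.Realizes (E.pull y₂ δ₁) m₁ e₁ → E.Realizes (E.pull y₁ δ₂) m₂ e₂ →
    Mem x₂ y₂ δ₂ → Mem m₁ e₁ (E.pull y₂ δ₁) → Mem x₁ y₁ δ₁

end

end Extriangulation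

/-! ## Exactness of Hom sequences -/

section

variable {C : Type u} [Category.{v} C] [Preadditive C]

/-- `0 ⟶ C(W, A) ⟶ C(W, B) ⟶ C(W, D) ⟶ 0` is exact. -/
def HomFromExact (W : C) {A B D : C} (x : A ⟶ B) (y : B ⟶ D) : Prop :=
  Function.Injective (fun f : W ⟶ A => f ≫ x) ∧
  Function.Exact (fun f : W ⟶ A => f ≫ x) (fun f : W ⟶ B => f ≫ y) ∧
  Function.Surjective (fun f : W ⟶ B => f ≫ y)

/-- `0 ⟶ C(D, W) ⟶ C(B, W) ⟶ C(A, W) ⟶ 0` is exact. -/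
def HomToExact (W : C) {A B D : C} (x : A ⟶ B) (y : B ⟶ D) : Prop :=
  Function.Injective (fun f : D ⟶ W => y ≫ f) ∧
  Function.Exact (fun f : D ⟶ W => y ≫ f) (fun f : B ⟶ W => x ≫ f) ∧
  Function.Surjective (fun f : B ⟶ W => x ≫ f)

end

namespace Extriangulation.ProperClass

section

variable {C : Type u} [Category.{v} C] [Preadditive C] [HasZeroObject C] [HasBinaryBiproducts C]
  {E : Extriangulation.{w} C}

/-! ## Projective and injective objects, dimensions -/

/-- `P` is `ξ`-projective. -/
def IsProj (ξ : E.ProperClass) (P : C) : Prop :=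
  ∀ ⦃A B D : C⦄ (x : A ⟶ B) (y : B ⟶ D) (δ : E.Ext D A), ξ.Mem x y δ → HomFromExact P x y

/-- `I` is `ξ`-injective. -/
def IsInj (ξ : E.ProperClass) (I : C) : Prop :=
  ∀ ⦃A B D : C⦄ (x : A ⟶ B) (y : B ⟶ D) (δ : E.Ext D A), ξ.Mem x y δ → HomToExact I x y

/-- There are enough `ξ`-projectives. -/
def EnoughProj (ξ : E.ProperClass) : Prop :=
  ∀ A : C, ∃ (K P : C) (x : K ⟶ P) (y : P ⟶ A) (δ : E.Ext A K), ξ.Mem x y δ ∧ ξ.IsProj P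

/-- There are enough `ξ`-injectives. -/
def EnoughInj (ξ : E.ProperClass) : Prop :=
  ∀ A : C, ∃ (I K : C) (x : A ⟶ I) (y : I ⟶ K) (δ : E.Ext K A), ξ.Mem x y δ ∧ ξ.IsInj I

/-- `ξ`-pd `A ≤ n`. -/
def ProjDimLE (ξ : E.ProperClass) : ℕ → C → Prop
  | 0, A => ξ.IsProj A
  | n + 1, A => ξ.IsProj A ∨ ∃ (K P : C) (x : K ⟶ P) (y : P ⟶ A) (δ : E.Ext A K),
      ξ.Mem x y δ ∧ ξ.IsProj P ∧ ProjDimLE ξ n K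

/-- `ξ`-id `A ≤ n`. -/
def InjDimLE (ξ : E.ProperClass) : ℕ → C → Prop
  | 0, A => ξ.IsInj A
  | n + 1, A => ξ.IsInj A ∨ ∃ (I K : C) (x : A ⟶ I) (y : I ⟶ K) (δ : E.Ext K A),
      ξ.Mem x y δ ∧ ξ.IsInj I ∧ InjDimLE ξ n K

/-- `ξ`-pd `A < ∞`. -/
def FiniteProjDim (ξ : E.ProperClass) (A : C) : Prop := ∃ n : ℕ, ξ.ProjDimLE n A

/-- `ξ`-id `A < ∞`. -/
def FiniteInjDim (ξ : E.ProperClass) (A : C) : Prop := ∃ n : ℕ, ξ.InjDimLE n A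

/-! ## Gorenstein projective and Gorenstein injective objects -/

/-- A `ξ`-exact complex, together with chosen `𝔼`-triangles
`K (n + 1) ⟶ X n ⟶ K n ⇢` in `ξ` through which its differentials factor. -/
structure ExactComplex (ξ : E.ProperClass) where
  complex : ChainComplex C ℤ
  K : ℤ → C
  g : ∀ n, K (n + 1) ⟶ complex.X n
  f : ∀ n, complex.X n ⟶ K n
  δ : ∀ n, E.Ext (K n) (K (n + 1))
  mem : ∀ n, ξ.Mem (g n) (f n) (δ n)
  d_eq : ∀ n, complex.d (n + 1) n = f (n + 1) ≫ g n

/-- A complete `ξ`-projective resolution (with respect to the chosen `𝔼`-triangles). -/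
def ExactComplex.IsCompleteProj {ξ : E.ProperClass} (T : ξ.ExactComplex) : Prop :=
  (∀ n, ξ.IsProj (T.complex.X n)) ∧ ∀ n, ∀ Q : C, ξ.IsProj Q → HomToExact Q (T.g n) (T.f n)

/-- A complete `ξ`-injective coresolution (with respect to the chosen `𝔼`-triangles). -/
def ExactComplex.IsCompleteInj {ξ : E.ProperClass} (T : ξ.ExactComplex) : Prop :=
  (∀ n, ξ.IsInj (T.complex.X n)) ∧ ∀ n, ∀ J : C, ξ.IsInj J → HomFromExact J (T.g n) (T.f n)

/-- `G` is `ξ`-`𝒢`projective. -/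
def IsGProj (ξ : E.ProperClass) (G : C) : Prop :=
  ∃ T : ξ.ExactComplex, T.IsCompleteProj ∧ ∃ n : ℤ, T.K n = G

/-- `G` is `ξ`-`𝒢`injective. -/
def IsGInj (ξ : E.ProperClass) (G : C) : Prop :=
  ∃ T : ξ.ExactComplex, T.IsCompleteInj ∧ ∃ n : ℤ, T.K n = G

/-! ## Resolutions, coresolutions and cohomology -/

/-- A `ξ`-exact complex `⋯ ⟶ X 1 ⟶ X 0 ⟶ M ⟶ 0`, with its `𝔼`-triangles
`K (n + 1) ⟶ X n ⟶ K n ⇢` in `ξ`, where `K 0 = M`. The complex `complex` is the deleted one,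
and `f 0` is the augmentation. -/
structure Resolution (ξ : E.ProperClass) (M : C) where
  complex : ChainComplex C ℕ
  K : ℕ → C
  K_zero : K 0 = M
  g : ∀ n, K (n + 1) ⟶ complex.X n
  f : ∀ n, complex.X n ⟶ K n
  δ : ∀ n, E.Ext (K n) (K (n + 1))
  mem : ∀ n, ξ.Mem (g n) (f n) (δ n)
  d_eq : ∀ n, complex.d (n + 1) n = f (n + 1) ≫ g n

/-- A `ξ`-exact complex `0 ⟶ N ⟶ X 0 ⟶ X 1 ⟶ ⋯`, with its `𝔼`-triangles
`K n ⟶ X n ⟶ K (n + 1) ⇢` in `ξ`, where `K 0 = N`. The complex `complex` is the deleted one,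
and `g 0` is the coaugmentation. -/
structure Coresolution (ξ : E.ProperClass) (N : C) where
  complex : CochainComplex C ℕ
  K : ℕ → C
  K_zero : K 0 = N
  g : ∀ n, K n ⟶ complex.X n
  f : ∀ n, complex.X n ⟶ K (n + 1)
  δ : ∀ n, E.Ext (K (n + 1)) (K n)
  mem : ∀ n, ξ.Mem (g n) (f n) (δ n)
  d_eq : ∀ n, complex.d n (n + 1) = f n ≫ g (n + 1)

variable {ξ : E.ProperClass}

/-- `R` is a `ξ`-projective resolution. -/
def Resolution.IsProj {M : C} (R : ξ.Resolution M) : Prop :=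
  ∀ n, ξ.IsProj (R.complex.X n)

/-- `R` is a `ξ`-`𝒢`projective resolution: each `f n` is a `ξ`-`𝒢`projective precover. -/
def Resolution.IsGProj {M : C} (R : ξ.Resolution M) : Prop :=
  ∀ n, ξ.IsGProj (R.complex.X n) ∧ ∀ G : C, ξ.IsGProj G → HomFromExact G (R.g n) (R.f n)

/-- `R` is a `ξ`-injective coresolution. -/
def Coresolution.IsInj {N : C} (R : ξ.Coresolution N) : Prop :=
  ∀ n, ξ.IsInj (R.complex.X n)

/-- `R` is a `ξ`-`𝒢`injective coresolution: each `g n` is a `ξ`-`𝒢`injective preenvelope. -/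
def Coresolution.IsGInj {N : C} (R : ξ.Coresolution N) : Prop :=
  ∀ n, ξ.IsGInj (R.complex.X n) ∧ ∀ G : C, ξ.IsGInj G → HomToExact G (R.g n) (R.f n)

/-- `Hⁿ(C(X, N))`, where `X` is the deleted complex of the resolution `R` of `M`. This is
`ξxt_P^n(M, N)` if `R` is a `ξ`-projective resolution and `ξxt_GP^n(M, N)` if `R` is a
`ξ`-`𝒢`projective resolution. -/
noncomputable def Resolution.cohomology {M : C} (R : ξ.Resolution M) (N : C) (n : ℕ) :
    AddCommGrpCat.{v} :=
  (((preadditiveYoneda.obj N).mapHomologicalComplex _).obj R.complex.op).homology n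

/-- `Hⁿ(C(M, X))`, where `X` is the deleted complex of the coresolution `R` of `N`. This is
`ξxt_I^n(M, N)` if `R` is a `ξ`-injective coresolution and `ξxt_GI^n(M, N)` if `R` is a
`ξ`-`𝒢`injective coresolution. -/
noncomputable def Coresolution.cohomology {N : C} (R : ξ.Coresolution N) (M : C) (n : ℕ) :
    AddCommGrpCat.{v} :=
  (((preadditiveCoyoneda.obj (op M)).mapHomologicalComplex _).obj R.complex).homology n

end

end Extriangulation.ProperClass

/-! Let `T` be a complete ξ-projective resolution and `L` an object of finite ξ-projective
dimension. Then `C(-, L)` is exact on the triangles of `T` (`homToExact_of_projDimLE`). This is an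
induction on the dimension of `L`, using that `C(T.K n, -)` is exact on a triangle `K ⟶ Q ⟶ L` of ξ
as soon as `C(-, K)` is exact on `T` (`ExactComplex.IsCompleteProj.homFromExact`).

If ξ-pd `M` is finite, then `M` has a ξ-projective resolution `F` whose syzygies all have finite
dimension. Hence `F` stays exact under `C(G, -)` for every ξ-𝒢projective `G`; as ξ-projectives are
ξ-𝒢projective, `F` is also a ξ-𝒢projective resolution. The comparison theorem makes each kind of
resolution unique up to homotopy, so `F` computes both cohomologies.

Passing to ξ-injective coresolutions is the balance of the two theories: `C(P, N)` and `C(M, I)`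
have the same cohomology, by dimension shifting along `I` (`exists_kernel_data`,
`nonempty_homology_iso_of_add_eq`). Statement (2) is dual. -/

open scoped ZeroObject

/-! ### Homological algebra of a single 𝔼-triangle -/

namespace Extriangulation

variable {C : Type u} [Category.{v} C] [Preadditive C] [HasZeroObject C] [HasBinaryBiproducts C]
  {E : Extriangulation.{w} C} {A B D : C} {x : A ⟶ B} {y : B ⟶ D} {δ : E.Ext D A}

lemma push_comp {A' A'' : C} (a : A ⟶ A') (a' : A' ⟶ A'') (ε : E.Ext D A) :
    E.push (a ≫ a') ε = E.push a' (E.push a ε) := by simp [push]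

lemma pull_comp {D' D'' : C} (d : D' ⟶ D) (d' : D'' ⟶ D') (ε : E.Ext D A) :
    E.pull (d' ≫ d) ε = E.pull d' (E.pull d ε) := by simp [pull]

lemma push_zero {A' : C} (a : A ⟶ A') : E.push a (0 : E.Ext D A) = 0 := by simp [push]

lemma pull_zero {D' : C} (d : D' ⟶ D) : E.pull d (0 : E.Ext D A) = 0 := by simp [pull]

/-- From here to `exists_extension_of_push_eq_zero`, everything comes from comparing the given
triangle with a suitable split one, through (ET3), (ET3)ᵒᵖ or the realization of morphisms. -/
lemma Realizes.comp_eq_zero (h : E.Realizes δ x y) : x ≫ y = 0 := by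
  obtain ⟨d, hd, -⟩ := E.et3 _ _ _ _ _ _ (E.realizes_zero A 0) h (𝟙 A) (biprod.fst ≫ x) (by simp)
  have := congr(biprod.inl ≫ $hd)
  simpa using this.symm

lemma Realizes.exists_lift (h : E.Realizes δ x y) {W : C} (f : W ⟶ B) (hf : f ≫ y = 0) :
    ∃ a : W ⟶ A, a ≫ x = f := by
  obtain ⟨a, ha, -⟩ := E.et3_op _ _ _ _ _ _ (E.realizes_zero W 0) h (biprod.fst ≫ f) 0
    (by simp [hf])
  exact ⟨a, by simpa using ha.symm⟩

lemma Realizes.exists_desc (h : E.Realizes δ x y) {W : C} (f : B ⟶ W) (hf : x ≫ f = 0) :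
    ∃ d : D ⟶ W, y ≫ d = f := by
  obtain ⟨d, hd, -⟩ := E.et3 _ _ _ _ _ _ h (E.realizes_zero 0 W) 0 (f ≫ biprod.inr)
    (by simp [reassoc_of% hf])
  exact ⟨d, by simpa using hd⟩

lemma Realizes.pull_eq_zero (h : E.Realizes δ x y) : E.pull y δ = 0 := by
  obtain ⟨a, -, ha⟩ := E.et3_op _ _ _ _ _ _ (E.realizes_zero 0 B) h biprod.snd y rfl
  simpa using ha.symm

lemma Realizes.push_eq_zero (h : E.Realizes δ x y) : E.push x δ = 0 := by
  obtain ⟨d, -, hd⟩ := E.et3 _ _ _ _ _ _ h (E.realizes_zero B 0) x biprod.inl rfl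
  simpa using hd

lemma Realizes.exists_lift_of_pull_eq_zero (h : E.Realizes δ x y) {W : C} (f : W ⟶ D)
    (hf : E.pull f δ = 0) : ∃ l : W ⟶ B, l ≫ y = f := by
  obtain ⟨b, -, hb⟩ := E.realization _ _ _ _ _ _ (E.realizes_zero A W) h (𝟙 A) f
    (by simpa [pull] using hf.symm)
  exact ⟨biprod.inr ≫ b, by simp [← hb]⟩

lemma Realizes.exists_extension_of_push_eq_zero (h : E.Realizes δ x y) {W : C} (f : A ⟶ W)
    (hf : E.push f δ = 0) : ∃ l : B ⟶ W, x ≫ l = f := by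
  obtain ⟨b, hb, -⟩ := E.realization _ _ _ _ _ _ h (E.realizes_zero W D) f (𝟙 D)
    (by simpa [push] using hf)
  exact ⟨b ≫ biprod.fst, by simp [reassoc_of% hb]⟩

/-- Since `y` pulls `ε` back to zero, it lifts to the middle term of a realization of `ε`; (ET3)ᵒᵖ
over `𝟙 D` then supplies `a`. -/
lemma Realizes.exists_push_eq (h : E.Realizes δ x y) {W : C} (ε : E.Ext D W)
    (hε : E.pull y ε = 0) : ∃ a : A ⟶ W, E.push a δ = ε := by
  obtain ⟨Z, w, z, hz⟩ := E.exists_realizes ε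
  obtain ⟨b, hb⟩ := hz.exists_lift_of_pull_eq_zero y hε
  obtain ⟨a, -, ha⟩ := E.et3_op _ _ _ _ _ _ h hz b (𝟙 D) (by simp [hb])
  exact ⟨a, by simpa using ha⟩

lemma Realizes.exists_pull_eq (h : E.Realizes δ x y) {W : C} (ε : E.Ext W A)
    (hε : E.push x ε = 0) : ∃ d : W ⟶ D, E.pull d δ = ε := by
  obtain ⟨Z, w, z, hz⟩ := E.exists_realizes ε
  obtain ⟨b, hb⟩ := hz.exists_extension_of_push_eq_zero x hε
  obtain ⟨d, -, hd⟩ := E.et3 _ _ _ _ _ _ hz h (𝟙 A) b (by simp [hb])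
  exact ⟨d, by simpa using hd.symm⟩

/-- Exactness in the middle is automatic, `x` being a weak kernel of `y`. Injectivity has to be
assumed: an inflation need not be a monomorphism. -/
lemma Realizes.homFromExact (h : E.Realizes δ x y) {W : C}
    (hinj : ∀ f : W ⟶ A, f ≫ x = 0 → f = 0) (hsurj : ∀ f : W ⟶ D, ∃ l : W ⟶ B, l ≫ y = f) :
    HomFromExact W x y := by
  refine ⟨fun f g hfg => sub_eq_zero.1 (hinj _ ?_), fun f => ⟨h.exists_lift f, ?_⟩, hsurj⟩
  · simpa [sub_eq_zero] using hfg
  · rintro ⟨a, rfl⟩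
    simp [h.comp_eq_zero]

lemma Realizes.homToExact (h : E.Realizes δ x y) {W : C}
    (hinj : ∀ f : D ⟶ W, y ≫ f = 0 → f = 0) (hsurj : ∀ f : A ⟶ W, ∃ l : B ⟶ W, x ≫ l = f) :
    HomToExact W x y := by
  refine ⟨fun f g hfg => sub_eq_zero.1 (hinj _ ?_), fun f => ⟨h.exists_desc f, ?_⟩, hsurj⟩
  · simpa [sub_eq_zero] using hfg
  · rintro ⟨a, rfl⟩
    simp [← Category.assoc, h.comp_eq_zero]

end Extriangulation

section

variable {C : Type u} [Category.{v} C] [Preadditive C] {W A B D : C} {x : A ⟶ B} {y : B ⟶ D}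

lemma HomFromExact.eq_zero (h : HomFromExact W x y) {f : W ⟶ A} (hf : f ≫ x = 0) : f = 0 :=
  h.1 (by simpa using hf)

lemma HomFromExact.exists_lift (h : HomFromExact W x y) (f : W ⟶ D) : ∃ l : W ⟶ B, l ≫ y = f :=
  h.2.2 f

lemma HomToExact.eq_zero (h : HomToExact W x y) {f : D ⟶ W} (hf : y ≫ f = 0) : f = 0 :=
  h.1 (by simpa using hf)

lemma HomToExact.exists_extension (h : HomToExact W x y) (f : A ⟶ W) :
    ∃ l : B ⟶ W, x ≫ l = f :=
  h.2.2 f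

end

/-! ### Gorenstein objects against objects of finite dimension -/

namespace Extriangulation.ProperClass

variable {C : Type u} [Category.{v} C] [Preadditive C] [HasZeroObject C] [HasBinaryBiproducts C]
  {E : Extriangulation.{w} C} {ξ : E.ProperClass}

lemma IsProj.biprod {P Q : C} (hP : ξ.IsProj P) (hQ : ξ.IsProj Q) : ξ.IsProj (P ⊞ Q) := by
  intro A B D x y δ h
  refine (ξ.realizes _ _ _ h).homFromExact (fun f hf => ?_) (fun f => ?_)
  · ext
    · simpa using (hP _ _ _ h).eq_zero (f := biprod.inl ≫ f) (by simp [hf])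
    · simpa using (hQ _ _ _ h).eq_zero (f := biprod.inr ≫ f) (by simp [hf])
  · obtain ⟨l, hl⟩ := (hP _ _ _ h).exists_lift (biprod.inl ≫ f)
    obtain ⟨m, hm⟩ := (hQ _ _ _ h).exists_lift (biprod.inr ≫ f)
    exact ⟨biprod.desc l m, by ext <;> simp [hl, hm]⟩

lemma IsInj.biprod {P Q : C} (hP : ξ.IsInj P) (hQ : ξ.IsInj Q) : ξ.IsInj (P ⊞ Q) := by
  intro A B D x y δ h
  refine (ξ.realizes _ _ _ h).homToExact (fun f hf => ?_) (fun f => ?_)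
  · ext
    · simpa using (hP _ _ _ h).eq_zero (f := f ≫ biprod.fst) (by simp [reassoc_of% hf])
    · simpa using (hQ _ _ _ h).eq_zero (f := f ≫ biprod.snd) (by simp [reassoc_of% hf])
  · obtain ⟨l, hl⟩ := (hP _ _ _ h).exists_extension (f ≫ biprod.fst)
    obtain ⟨m, hm⟩ := (hQ _ _ _ h).exists_extension (f ≫ biprod.snd)
    exact ⟨biprod.lift l m, by ext <;> simp [hl, hm]⟩

lemma mem_biprod_inl_snd (ξ : E.ProperClass) (A D : C) :
    ξ.Mem (biprod.inl : A ⟶ A ⊞ D) (biprod.snd : A ⊞ D ⟶ D) 0 :=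
  ξ.mem_split _ _ (E.realizes_zero A D)

lemma homToExact_biprod (E : Extriangulation.{w} C) (A D Q : C) :
    HomToExact Q (biprod.inl : A ⟶ A ⊞ D) (biprod.snd : A ⊞ D ⟶ D) :=
  (E.realizes_zero A D).homToExact
    (fun f hf => by simpa using congr(biprod.inr ≫ $hf)) (fun f => ⟨biprod.fst ≫ f, by simp⟩)

lemma homFromExact_biprod (E : Extriangulation.{w} C) (A D Q : C) :
    HomFromExact Q (biprod.inl : A ⟶ A ⊞ D) (biprod.snd : A ⊞ D ⟶ D) :=
  (E.realizes_zero A D).homFromExact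
    (fun f hf => by simpa using congr($hf ≫ biprod.fst)) (fun f => ⟨f ≫ biprod.inr, by simp⟩)

/-- The `ξ`-exact complex with all `K n` equal to `P` and all `X n` equal to `P ⊞ P`. -/
noncomputable def splitExactComplex (ξ : E.ProperClass) (P : C) : ξ.ExactComplex where
  complex := ChainComplex.of (fun _ : ℤ => P ⊞ P) (fun _ => biprod.snd ≫ biprod.inl)
    (fun _ => by simp)
  K _ := P
  g _ := biprod.inl
  f _ := biprod.snd
  δ _ := 0
  mem _ := ξ.mem_biprod_inl_snd P P
  d_eq n := ChainComplex.of_d (fun _ : ℤ => P ⊞ P) (fun _ => biprod.snd ≫ biprod.inl) n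

/-- Split triangles are exact under every Hom functor, so the constant split complex is complete.
The same complex serves the injective case. -/
lemma IsProj.isGProj {P : C} (hP : ξ.IsProj P) : ξ.IsGProj P :=
  ⟨ξ.splitExactComplex P, ⟨fun _ => hP.biprod hP, fun _ Q _ => homToExact_biprod E P P Q⟩, 0, rfl⟩

lemma IsInj.isGInj {P : C} (hP : ξ.IsInj P) : ξ.IsGInj P :=
  ⟨ξ.splitExactComplex P, ⟨fun _ => hP.biprod hP, fun _ Q _ => homFromExact_biprod E P P Q⟩,
    0, rfl⟩

/-- The obstruction to lifting `f` is its pullback of `δ`. It dies on the projective `T.X n`, so it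
is a pushforward of `T.δ n` along some `a`; by `hK`, `a` extends along `T.g n`, which kills `T.δ n`.
-/
lemma ExactComplex.IsCompleteProj.homFromExact {T : ξ.ExactComplex} (hT : T.IsCompleteProj)
    {K Q L : C} {x : K ⟶ Q} {y : Q ⟶ L} {δ : E.Ext L K} (h : ξ.Mem x y δ)
    (hK : ∀ n, HomToExact K (T.g n) (T.f n)) (n : ℤ) : HomFromExact (T.K n) x y := by
  have hr := ξ.realizes _ _ _ h
  have hTr := ξ.realizes _ _ _ (T.mem n)
  refine hr.homFromExact (fun k hk => (hK n).eq_zero ?_) (fun f => ?_)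
  · exact (hT.1 n _ _ _ h).eq_zero (by simp [hk])
  · apply hr.exists_lift_of_pull_eq_zero
    obtain ⟨p, hp⟩ := (hT.1 n _ _ _ h).exists_lift (T.f n ≫ f)
    obtain ⟨a, ha⟩ := hTr.exists_push_eq (E.pull f δ)
      (by rw [← pull_comp, ← hp, pull_comp, hr.pull_eq_zero, pull_zero])
    obtain ⟨b, rfl⟩ := (hK n).exists_extension a
    rw [← ha, push_comp, hTr.push_eq_zero, push_zero]

/-- Dual argument; the object concerned is now the left end of the `n`-th triangle, whence the index
`n + 1`. -/
lemma ExactComplex.IsCompleteInj.homToExact {T : ξ.ExactComplex} (hT : T.IsCompleteInj)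
    {K Q L : C} {x : L ⟶ Q} {y : Q ⟶ K} {δ : E.Ext K L} (h : ξ.Mem x y δ)
    (hK : ∀ n, HomFromExact K (T.g n) (T.f n)) (n : ℤ) : HomToExact (T.K (n + 1)) x y := by
  have hr := ξ.realizes _ _ _ h
  have hTr := ξ.realizes _ _ _ (T.mem n)
  refine hr.homToExact (fun k hk => (hK n).eq_zero ?_) (fun f => ?_)
  · exact (hT.1 n _ _ _ h).eq_zero (by simp [reassoc_of% hk])
  · apply hr.exists_extension_of_push_eq_zero
    obtain ⟨p, hp⟩ := (hT.1 n _ _ _ h).exists_extension (f ≫ T.g n)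
    obtain ⟨a, ha⟩ := hTr.exists_pull_eq (E.push f δ)
      (by rw [← push_comp, ← hp, push_comp, hr.push_eq_zero, push_zero])
    obtain ⟨b, rfl⟩ := (hK n).exists_lift a
    rw [← ha, pull_comp, hTr.pull_eq_zero, pull_zero]

/-- Removes the alternative in the definition: for `A` ξ-projective, the split triangle with both
ends `A` serves. -/
lemma ProjDimLE.exists_mem {n : ℕ} {A : C} (h : ξ.ProjDimLE (n + 1) A) :
    ∃ (K P : C) (x : K ⟶ P) (y : P ⟶ A) (δ : E.Ext A K),
      ξ.Mem x y δ ∧ ξ.IsProj P ∧ ξ.ProjDimLE n K := by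
  rcases h with h | h
  · exact ⟨A, A ⊞ A, _, _, _, ξ.mem_biprod_inl_snd A A, h.biprod h, by
      cases n with
      | zero => exact h
      | succ n => exact Or.inl h⟩
  · exact h

lemma InjDimLE.exists_mem {n : ℕ} {A : C} (h : ξ.InjDimLE (n + 1) A) :
    ∃ (I K : C) (x : A ⟶ I) (y : I ⟶ K) (δ : E.Ext K A),
      ξ.Mem x y δ ∧ ξ.IsInj I ∧ ξ.InjDimLE n K := by
  rcases h with h | h
  · exact ⟨A ⊞ A, A, _, _, _, ξ.mem_biprod_inl_snd A A, h.biprod h, by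
      cases n with
      | zero => exact h
      | succ n => exact Or.inl h⟩
  · exact h

/-- A diagram chase: `C(T.K n, -)` is exact on `K ⟶ Q ⟶ L` by the induction hypothesis for `K`, and
`C(-, Q)` is exact on `T` by completeness. -/
lemma ExactComplex.IsCompleteProj.homToExact_of_projDimLE {T : ξ.ExactComplex}
    (hT : T.IsCompleteProj) {m : ℕ} {L : C} (hL : ξ.ProjDimLE m L) (n : ℤ) :
    HomToExact L (T.g n) (T.f n) := by
  induction m generalizing L n with
  | zero => exact hT.2 n L hL
  | succ m ih =>
    obtain ⟨K, Q, x, y, δ, h, hQ, hK⟩ := hL.exists_mem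
    have hrow := hT.homFromExact h (fun n => ih hK n)
    have hr := ξ.realizes _ _ _ h
    have hTr := ξ.realizes _ _ _ (T.mem n)
    refine hTr.homToExact (fun f hf => ?_) (fun f => ?_)
    · obtain ⟨q, rfl⟩ := (hrow n).exists_lift f
      obtain ⟨k, hk⟩ := hr.exists_lift (T.f n ≫ q) (by simpa using hf)
      have hgk : T.g n ≫ k = 0 := (hrow (n + 1)).eq_zero (by
        rw [Category.assoc, hk, ← Category.assoc, hTr.comp_eq_zero, zero_comp])
      -- The lift `q` need not vanish; it factors through `x`, which already forces `q ≫ y = 0`.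
      obtain ⟨k', rfl⟩ := hTr.exists_desc k hgk
      have : k' ≫ x = q := (hT.2 n Q hQ).1 (by simpa using hk)
      rw [← this, Category.assoc, hr.comp_eq_zero, comp_zero]
    · obtain ⟨q, rfl⟩ := (hrow (n + 1)).exists_lift f
      obtain ⟨p, rfl⟩ := (hT.2 n Q hQ).exists_extension q
      exact ⟨p ≫ y, by simp⟩

lemma ExactComplex.IsCompleteInj.homFromExact_of_injDimLE {T : ξ.ExactComplex}
    (hT : T.IsCompleteInj) {m : ℕ} {L : C} (hL : ξ.InjDimLE m L) (n : ℤ) :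
    HomFromExact L (T.g n) (T.f n) := by
  induction m generalizing L n with
  | zero => exact hT.2 n L hL
  | succ m ih =>
    obtain ⟨Q, K, x, y, δ, h, hQ, hK⟩ := hL.exists_mem
    have hrow' := hT.homToExact h (fun n => ih hK n)
    -- The complex is indexed by ℤ, so the shift in `homToExact` can be undone.
    have hrow : ∀ n, HomToExact (T.K n) x y := fun n => by simpa using hrow' (n - 1)
    have hr := ξ.realizes _ _ _ h
    have hTr := ξ.realizes _ _ _ (T.mem n)
    refine hTr.homFromExact (fun f hf => ?_) (fun f => ?_)
    · obtain ⟨q, rfl⟩ := (hrow (n + 1)).exists_extension f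
      obtain ⟨k, hk⟩ := hr.exists_desc (q ≫ T.g n) (by simpa using hf)
      have hgk : k ≫ T.f n = 0 := (hrow n).eq_zero (by
        rw [← Category.assoc, hk, Category.assoc, hTr.comp_eq_zero, comp_zero])
      obtain ⟨k', rfl⟩ := hTr.exists_lift k hgk
      have : y ≫ k' = q := (hT.2 n Q hQ).1 (by simpa using hk)
      rw [← this, ← Category.assoc, hr.comp_eq_zero, zero_comp]
    · obtain ⟨q, rfl⟩ := (hrow n).exists_extension f
      obtain ⟨p, rfl⟩ := (hT.2 n Q hQ).exists_lift q
      exact ⟨x ≫ p, by simp⟩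

/-- An object of finite projective dimension has a `ξ`-projective precover which remains exact
under maps from Gorenstein projective objects and whose kernel has finite dimension. -/
lemma FiniteProjDim.exists_mem {A : C} (h : ξ.FiniteProjDim A) :
    ∃ (K P : C) (x : K ⟶ P) (y : P ⟶ A) (δ : E.Ext A K), ξ.Mem x y δ ∧
      (ξ.IsProj P ∧ ∀ G : C, ξ.IsGProj G → HomFromExact G x y) ∧ ξ.FiniteProjDim K := by
  obtain ⟨n, hn⟩ := h
  -- Weakening the bound by one lets `ProjDimLE.exists_mem` apply even when `n = 0`.
  have hn : ξ.ProjDimLE (n + 1) A := by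
    induction n generalizing A with
    | zero => exact Or.inl hn
    | succ n ih =>
      rcases hn with hn | ⟨K, P, x, y, δ, hm, hP, hK⟩
      · exact Or.inl hn
      · exact Or.inr ⟨K, P, x, y, δ, hm, hP, ih hK⟩
  obtain ⟨K, P, x, y, δ, hm, hP, hK⟩ := hn.exists_mem
  refine ⟨K, P, x, y, δ, hm, ⟨hP, ?_⟩, n, hK⟩
  rintro _ ⟨T, hT, i, rfl⟩
  exact hT.homFromExact hm (hT.homToExact_of_projDimLE hK) i

lemma FiniteInjDim.exists_mem {A : C} (h : ξ.FiniteInjDim A) :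
    ∃ (I K : C) (x : A ⟶ I) (y : I ⟶ K) (δ : E.Ext K A), ξ.Mem x y δ ∧
      (ξ.IsInj I ∧ ∀ G : C, ξ.IsGInj G → HomToExact G x y) ∧ ξ.FiniteInjDim K := by
  obtain ⟨n, hn⟩ := h
  have hn : ξ.InjDimLE (n + 1) A := by
    induction n generalizing A with
    | zero => exact Or.inl hn
    | succ n ih =>
      rcases hn with hn | ⟨K, P, x, y, δ, hm, hP, hK⟩
      · exact Or.inl hn
      · exact Or.inr ⟨K, P, x, y, δ, hm, hP, ih hK⟩
  obtain ⟨I, K, x, y, δ, hm, hP, hK⟩ := hn.exists_mem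
  refine ⟨I, K, x, y, δ, hm, ⟨hP, ?_⟩, n, hK⟩
  rintro _ ⟨T, hT, i, rfl⟩
  -- `T.K i` is the left end of the triangle of index `i - 1`.
  simpa using hT.homToExact hm (hT.homFromExact_of_injDimLE hK) (i - 1)

/-! ### Existence of resolutions and coresolutions -/

/-- Objects with a property inherited by suitable syzygies have resolutions by suitable
triangles. -/
lemma Resolution.exists_of_syzygies {𝒟 : C → Prop}
    {good : ∀ ⦃A B D : C⦄, (A ⟶ B) → (B ⟶ D) → Prop}
    (h : ∀ A, 𝒟 A → ∃ (K X : C) (x : K ⟶ X) (y : X ⟶ A) (δ : E.Ext A K),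
      ξ.Mem x y δ ∧ good x y ∧ 𝒟 K) {M : C} (hM : 𝒟 M) :
    ∃ R : ξ.Resolution M, ∀ n, good (R.g n) (R.f n) := by
  choose K X x y δ hm hg hK using h
  -- The syzygies are iterated together with the proof of `𝒟`, on which the chosen triangles depend.
  let s : ℕ → {A // 𝒟 A} := fun n => Nat.rec ⟨M, hM⟩ (fun _ A => ⟨K A.1 A.2, hK A.1 A.2⟩) n
  exact ⟨{
    complex := ChainComplex.of (fun n => X (s n).1 (s n).2)
      (fun n => y (s (n + 1)).1 (s (n + 1)).2 ≫ x (s n).1 (s n).2) (fun n => by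
        have := (ξ.realizes _ _ _ (hm (s (n + 1)).1 (s (n + 1)).2)).comp_eq_zero
        rw [Category.assoc]
        erw [reassoc_of% this]
        simp)
    K := fun n => (s n).1
    K_zero := rfl
    g := fun n => x (s n).1 (s n).2
    f := fun n => y (s n).1 (s n).2
    δ := fun n => δ (s n).1 (s n).2
    mem := fun n => hm _ _
    d_eq := ChainComplex.of_d (fun n => X (s n).1 (s n).2)
      (fun n => y (s (n + 1)).1 (s (n + 1)).2 ≫ x (s n).1 (s n).2) }, fun n => hg _ _⟩

lemma Coresolution.exists_of_cosyzygies {𝒟 : C → Prop}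
    {good : ∀ ⦃A B D : C⦄, (A ⟶ B) → (B ⟶ D) → Prop}
    (h : ∀ A, 𝒟 A → ∃ (X K : C) (x : A ⟶ X) (y : X ⟶ K) (δ : E.Ext K A),
      ξ.Mem x y δ ∧ good x y ∧ 𝒟 K) {N : C} (hN : 𝒟 N) :
    ∃ R : ξ.Coresolution N, ∀ n, good (R.g n) (R.f n) := by
  choose X K x y δ hm hg hK using h
  let s : ℕ → {A // 𝒟 A} := fun n => Nat.rec ⟨N, hN⟩ (fun _ A => ⟨K A.1 A.2, hK A.1 A.2⟩) n
  exact ⟨{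
    complex := CochainComplex.of (fun n => X (s n).1 (s n).2)
      (fun n => y (s n).1 (s n).2 ≫ x (s (n + 1)).1 (s (n + 1)).2) (fun n => by
        have := (ξ.realizes _ _ _ (hm (s (n + 1)).1 (s (n + 1)).2)).comp_eq_zero
        rw [Category.assoc]
        erw [reassoc_of% this]
        simp)
    K := fun n => (s n).1
    K_zero := rfl
    g := fun n => x (s n).1 (s n).2
    f := fun n => y (s n).1 (s n).2
    δ := fun n => δ (s n).1 (s n).2
    mem := fun n => hm _ _
    d_eq := CochainComplex.of_d (fun n => X (s n).1 (s n).2)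
      (fun n => y (s n).1 (s n).2 ≫ x (s (n + 1)).1 (s (n + 1)).2) }, fun n => hg _ _⟩

lemma EnoughProj.exists_resolution (h : ξ.EnoughProj) (M : C) :
    ∃ P : ξ.Resolution M, P.IsProj :=
  Resolution.exists_of_syzygies (𝒟 := fun _ => True) (good := fun _ B _ _ _ => ξ.IsProj B)
    (fun A _ => by
      obtain ⟨K, P, x, y, δ, hm, hP⟩ := h A
      exact ⟨K, P, x, y, δ, hm, hP, trivial⟩) trivial

lemma EnoughInj.exists_coresolution (h : ξ.EnoughInj) (N : C) :
    ∃ I : ξ.Coresolution N, I.IsInj :=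
  Coresolution.exists_of_cosyzygies (𝒟 := fun _ => True) (good := fun _ B _ _ _ => ξ.IsInj B)
    (fun A _ => by
      obtain ⟨K, P, x, y, δ, hm, hP⟩ := h A
      exact ⟨K, P, x, y, δ, hm, hP, trivial⟩) trivial

lemma FiniteProjDim.exists_resolution {M : C} (h : ξ.FiniteProjDim M) :
    ∃ R : ξ.Resolution M, R.IsProj ∧ R.IsGProj := by
  obtain ⟨R, hR⟩ := Resolution.exists_of_syzygies
    (good := fun _ B _ x y => ξ.IsProj B ∧ ∀ G : C, ξ.IsGProj G → HomFromExact G x y)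
    (fun A hA => FiniteProjDim.exists_mem hA) h
  exact ⟨R, fun n => (hR n).1, fun n => ⟨(hR n).1.isGProj, (hR n).2⟩⟩

lemma FiniteInjDim.exists_coresolution {N : C} (h : ξ.FiniteInjDim N) :
    ∃ R : ξ.Coresolution N, R.IsInj ∧ R.IsGInj := by
  obtain ⟨R, hR⟩ := Coresolution.exists_of_cosyzygies
    (good := fun _ B _ x y => ξ.IsInj B ∧ ∀ G : C, ξ.IsGInj G → HomToExact G x y)
    (fun A hA => FiniteInjDim.exists_mem hA) h
  exact ⟨R, fun n => (hR n).1, fun n => ⟨(hR n).1.isGInj, (hR n).2⟩⟩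

end Extriangulation.ProperClass

/-! ### The comparison theorem -/

section Comparison

variable {C : Type u} [Category.{v} C] [Preadditive C]

/-- The functor `C(W, -)` takes the augmented complex `⋯ ⟶ Y 1 ⟶ Y 0 ⟶ M ⟶ 0` to an exact
sequence. -/
structure IsHomFromAcyclic (W : C) (Y : ChainComplex C ℕ) {M : C} (η : Y.X 0 ⟶ M) : Prop where
  exists_lift : ∀ f : W ⟶ M, ∃ l : W ⟶ Y.X 0, l ≫ η = f
  exists_lift_zero : ∀ f : W ⟶ Y.X 0, f ≫ η = 0 → ∃ l : W ⟶ Y.X 1, l ≫ Y.d 1 0 = f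
  exists_lift_succ : ∀ (n : ℕ) (f : W ⟶ Y.X (n + 1)), f ≫ Y.d (n + 1) n = 0 →
    ∃ l : W ⟶ Y.X (n + 2), l ≫ Y.d (n + 2) (n + 1) = f

/-- The functor `C(-, W)` takes the coaugmented complex `0 ⟶ N ⟶ X 0 ⟶ X 1 ⟶ ⋯` to an exact
sequence. -/
structure IsHomToAcyclic (W : C) (X : CochainComplex C ℕ) {N : C} (ε : N ⟶ X.X 0) : Prop where
  exists_extension : ∀ f : N ⟶ W, ∃ l : X.X 0 ⟶ W, ε ≫ l = f
  exists_extension_zero : ∀ f : X.X 0 ⟶ W, ε ≫ f = 0 → ∃ l : X.X 1 ⟶ W, X.d 0 1 ≫ l = f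
  exists_extension_succ : ∀ (n : ℕ) (f : X.X (n + 1) ⟶ W), X.d n (n + 1) ≫ f = 0 →
    ∃ l : X.X (n + 2) ⟶ W, X.d (n + 1) (n + 2) ≫ l = f

/-- The terms of `X` only have to lift against `Y`, so the usual inductive construction covers
ξ-projective and ξ-𝒢projective resolutions alike. -/
lemma exists_chainMap_of_isHomFromAcyclic {X Y : ChainComplex C ℕ} {M : C} {ε : X.X 0 ⟶ M}
    {η : Y.X 0 ⟶ M} (hε : X.d 1 0 ≫ ε = 0) (h : ∀ n, IsHomFromAcyclic (X.X n) Y η) :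
    ∃ φ : X ⟶ Y, φ.f 0 ≫ η = ε := by
  obtain ⟨zero, hzero⟩ := (h 0).exists_lift ε
  obtain ⟨one, hone⟩ := (h 1).exists_lift_zero (X.d 1 0 ≫ zero) (by simp [hzero, hε])
  refine ⟨ChainComplex.mkHom X Y zero one hone (fun n p => ?_), hzero⟩
  have := (h (n + 2)).exists_lift_succ n (X.d (n + 2) (n + 1) ≫ p.2.1) (by simp [p.2.2])
  exact ⟨this.choose, this.choose_spec⟩

lemma nonempty_homotopy_zero_of_isHomFromAcyclic {X Y : ChainComplex C ℕ} {M : C}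
    {η : Y.X 0 ⟶ M} (h : ∀ n, IsHomFromAcyclic (X.X n) Y η) (φ : X ⟶ Y) (hφ : φ.f 0 ≫ η = 0) :
    Nonempty (Homotopy φ 0) := by
  obtain ⟨zero, hzero⟩ := (h 0).exists_lift_zero (φ.f 0) hφ
  obtain ⟨one, hone⟩ := (h 1).exists_lift_succ 0 (φ.f 1 - X.d 1 0 ≫ zero) (by simp [hzero])
  refine ⟨Homotopy.mkInductive φ zero hzero.symm one (by simp [hone]) (fun n p => ?_)⟩
  have := (h (n + 2)).exists_lift_succ (n + 1) (φ.f (n + 2) - X.d (n + 2) (n + 1) ≫ p.2.1) (by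
    -- Composing the preceding homotopy relation with `d` shows that the remaining error is a cycle.
    have hp := congr(X.d (n + 2) (n + 1) ≫ $(p.2.2))
    simp only [Preadditive.comp_add, HomologicalComplex.d_comp_d_assoc, zero_comp, zero_add] at hp
    simp [hp])
  exact ⟨this.choose, by simp [this.choose_spec]⟩

/-- Two augmented complexes whose terms have the lifting property with respect to both are
homotopy equivalent. -/
lemma nonempty_homotopyEquiv_of_isHomFromAcyclic {X Y : ChainComplex C ℕ} {M : C}
    {ε : X.X 0 ⟶ M} {η : Y.X 0 ⟶ M} (hε : X.d 1 0 ≫ ε = 0) (hη : Y.d 1 0 ≫ η = 0)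
    (hXX : ∀ n, IsHomFromAcyclic (X.X n) X ε) (hXY : ∀ n, IsHomFromAcyclic (X.X n) Y η)
    (hYX : ∀ n, IsHomFromAcyclic (Y.X n) X ε) (hYY : ∀ n, IsHomFromAcyclic (Y.X n) Y η) :
    Nonempty (HomotopyEquiv X Y) := by
  obtain ⟨φ, hφ⟩ := exists_chainMap_of_isHomFromAcyclic hε hXY
  obtain ⟨ψ, hψ⟩ := exists_chainMap_of_isHomFromAcyclic hη hYX
  obtain ⟨h₁⟩ := nonempty_homotopy_zero_of_isHomFromAcyclic hXX (φ ≫ ψ - 𝟙 X) (by simp [hφ, hψ])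
  obtain ⟨h₂⟩ := nonempty_homotopy_zero_of_isHomFromAcyclic hYY (ψ ≫ φ - 𝟙 Y) (by simp [hφ, hψ])
  exact ⟨⟨φ, ψ, Homotopy.equivSubZero.symm h₁, Homotopy.equivSubZero.symm h₂⟩⟩

lemma exists_cochainMap_of_isHomToAcyclic {X Y : CochainComplex C ℕ} {N : C} {ε : N ⟶ X.X 0}
    {η : N ⟶ Y.X 0} (hη : η ≫ Y.d 0 1 = 0) (h : ∀ n, IsHomToAcyclic (Y.X n) X ε) :
    ∃ φ : X ⟶ Y, ε ≫ φ.f 0 = η := by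
  obtain ⟨zero, hzero⟩ := (h 0).exists_extension η
  obtain ⟨one, hone⟩ := (h 1).exists_extension_zero (zero ≫ Y.d 0 1)
    (by simp [reassoc_of% hzero, hη])
  refine ⟨CochainComplex.mkHom X Y zero one hone.symm (fun n p => ?_), hzero⟩
  have := (h (n + 2)).exists_extension_succ n (p.2.1 ≫ Y.d (n + 1) (n + 2))
    (by simp [← reassoc_of% p.2.2])
  exact ⟨this.choose, this.choose_spec.symm⟩

lemma nonempty_homotopy_zero_of_isHomToAcyclic {X Y : CochainComplex C ℕ} {N : C}
    {ε : N ⟶ X.X 0} (h : ∀ n, IsHomToAcyclic (Y.X n) X ε) (φ : X ⟶ Y) (hφ : ε ≫ φ.f 0 = 0) :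
    Nonempty (Homotopy φ 0) := by
  obtain ⟨zero, hzero⟩ := (h 0).exists_extension_zero (φ.f 0) hφ
  obtain ⟨one, hone⟩ := (h 1).exists_extension_succ 0 (φ.f 1 - zero ≫ Y.d 0 1)
    (by simp [reassoc_of% hzero])
  refine ⟨Homotopy.mkCoinductive φ zero hzero.symm one (by simp [hone]) (fun n p => ?_)⟩
  have := (h (n + 2)).exists_extension_succ (n + 1) (φ.f (n + 2) - p.2.1 ≫ Y.d (n + 1) (n + 2))
    (by
      have hp := congr($(p.2.2) ≫ Y.d (n + 1) (n + 2))
      simp only [Preadditive.add_comp, Category.assoc, HomologicalComplex.d_comp_d, comp_zero,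
        zero_add] at hp
      simp [← hp])
  exact ⟨this.choose, by simp [this.choose_spec]⟩

lemma nonempty_homotopyEquiv_of_isHomToAcyclic {X Y : CochainComplex C ℕ} {N : C}
    {ε : N ⟶ X.X 0} {η : N ⟶ Y.X 0} (hε : ε ≫ X.d 0 1 = 0) (hη : η ≫ Y.d 0 1 = 0)
    (hXX : ∀ n, IsHomToAcyclic (X.X n) X ε) (hXY : ∀ n, IsHomToAcyclic (X.X n) Y η)
    (hYX : ∀ n, IsHomToAcyclic (Y.X n) X ε) (hYY : ∀ n, IsHomToAcyclic (Y.X n) Y η) :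
    Nonempty (HomotopyEquiv X Y) := by
  obtain ⟨φ, hφ⟩ := exists_cochainMap_of_isHomToAcyclic hη hYX
  obtain ⟨ψ, hψ⟩ := exists_cochainMap_of_isHomToAcyclic hε hXY
  obtain ⟨h₁⟩ := nonempty_homotopy_zero_of_isHomToAcyclic hXX (φ ≫ ψ - 𝟙 X)
    (by simp [reassoc_of% hφ, hψ])
  obtain ⟨h₂⟩ := nonempty_homotopy_zero_of_isHomToAcyclic hYY (ψ ≫ φ - 𝟙 Y)
    (by simp [reassoc_of% hψ, hφ])
  exact ⟨⟨φ, ψ, Homotopy.equivSubZero.symm h₁, Homotopy.equivSubZero.symm h₂⟩⟩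

end Comparison

/-! ### Independence of the cohomology from the resolution -/

namespace Extriangulation.ProperClass

variable {C : Type u} [Category.{v} C] [Preadditive C] [HasZeroObject C] [HasBinaryBiproducts C]
  {E : Extriangulation.{w} C} {ξ : E.ProperClass}

lemma Resolution.d_comp_f {M : C} (R : ξ.Resolution M) (n : ℕ) :
    R.complex.d (n + 1) n ≫ R.f n = 0 := by
  rw [R.d_eq, Category.assoc, (ξ.realizes _ _ _ (R.mem n)).comp_eq_zero, comp_zero]

lemma Coresolution.g_comp_d {N : C} (R : ξ.Coresolution N) (n : ℕ) :
    R.g n ≫ R.complex.d n (n + 1) = 0 := by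
  rw [R.d_eq, ← Category.assoc, (ξ.realizes _ _ _ (R.mem n)).comp_eq_zero, zero_comp]

/-- The augmentation of a resolution. -/
def Resolution.aug {M : C} (R : ξ.Resolution M) : R.complex.X 0 ⟶ M := R.f 0 ≫ eqToHom R.K_zero

/-- The coaugmentation of a coresolution. -/
def Coresolution.coaug {N : C} (R : ξ.Coresolution N) : N ⟶ R.complex.X 0 :=
  eqToHom R.K_zero.symm ≫ R.g 0

lemma Resolution.d_comp_aug {M : C} (R : ξ.Resolution M) : R.complex.d 1 0 ≫ R.aug = 0 := by
  simp [aug, ← Category.assoc, R.d_comp_f 0]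

lemma Coresolution.coaug_comp_d {N : C} (R : ξ.Coresolution N) :
    R.coaug ≫ R.complex.d 0 1 = 0 := by
  simp [coaug, R.g_comp_d 0]

lemma Resolution.exists_lift_of_comp_f_eq_zero {M W : C} (R : ξ.Resolution M)
    (h : ∀ n, HomFromExact W (R.g n) (R.f n)) (n : ℕ) (f : W ⟶ R.complex.X n)
    (hf : f ≫ R.f n = 0) : ∃ l : W ⟶ R.complex.X (n + 1), l ≫ R.complex.d (n + 1) n = f := by
  obtain ⟨k, rfl⟩ := (ξ.realizes _ _ _ (R.mem n)).exists_lift f hf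
  obtain ⟨l, rfl⟩ := (h (n + 1)).exists_lift k
  exact ⟨l, by simp [R.d_eq]⟩

lemma Coresolution.exists_extension_of_g_comp_eq_zero {N W : C} (R : ξ.Coresolution N)
    (h : ∀ n, HomToExact W (R.g n) (R.f n)) (n : ℕ) (f : R.complex.X n ⟶ W)
    (hf : R.g n ≫ f = 0) : ∃ l : R.complex.X (n + 1) ⟶ W, R.complex.d n (n + 1) ≫ l = f := by
  obtain ⟨k, rfl⟩ := (ξ.realizes _ _ _ (R.mem n)).exists_desc f hf
  obtain ⟨l, rfl⟩ := (h (n + 1)).exists_extension k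
  exact ⟨l, by simp [R.d_eq]⟩

lemma Resolution.isHomFromAcyclic {M W : C} (R : ξ.Resolution M)
    (h : ∀ n, HomFromExact W (R.g n) (R.f n)) : IsHomFromAcyclic W R.complex R.aug where
  exists_lift f := by
    obtain ⟨l, hl⟩ := (h 0).exists_lift (f ≫ eqToHom R.K_zero.symm)
    exact ⟨l, by simp [aug, reassoc_of% hl]⟩
  exists_lift_zero f hf := R.exists_lift_of_comp_f_eq_zero h 0 f (by
    simpa [aug, ← Category.assoc] using hf)
  -- `R.g n` need not be a monomorphism, but the left exactness in `h` cancels it after maps from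
  -- `W`.
  exists_lift_succ n f hf := R.exists_lift_of_comp_f_eq_zero h (n + 1) f
    ((h n).eq_zero (by simpa [R.d_eq] using hf))

lemma Coresolution.isHomToAcyclic {N W : C} (R : ξ.Coresolution N)
    (h : ∀ n, HomToExact W (R.g n) (R.f n)) : IsHomToAcyclic W R.complex R.coaug where
  exists_extension f := by
    obtain ⟨l, hl⟩ := (h 0).exists_extension (eqToHom R.K_zero ≫ f)
    exact ⟨l, by simp [coaug, hl]⟩
  exists_extension_zero f hf := R.exists_extension_of_g_comp_eq_zero h 0 f (by
    simpa [coaug] using hf)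
  exists_extension_succ n f hf := R.exists_extension_of_g_comp_eq_zero h (n + 1) f
    ((h n).eq_zero (by simpa [R.d_eq] using hf))

lemma Resolution.nonempty_cohomology_iso_of_homotopyEquiv {M M' : C} {R : ξ.Resolution M}
    {S : ξ.Resolution M'} (e : HomotopyEquiv R.complex S.complex) (N : C) (n : ℕ) :
    Nonempty (R.cohomology N n ≅ S.cohomology N n) := by
  let e' : HomotopyEquiv R.complex.op S.complex.op :=
    { hom := (HomologicalComplex.opFunctor C _).map e.inv.op
      inv := (HomologicalComplex.opFunctor C _).map e.hom.op
      homotopyHomInvId := e.homotopyHomInvId.op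
      homotopyInvHomId := e.homotopyInvHomId.op }
  exact ⟨((preadditiveYoneda.obj N).mapHomotopyEquiv e').toHomologyIso n⟩

lemma Coresolution.nonempty_cohomology_iso_of_homotopyEquiv {N N' : C} {R : ξ.Coresolution N}
    {S : ξ.Coresolution N'} (e : HomotopyEquiv R.complex S.complex) (M : C) (n : ℕ) :
    Nonempty (R.cohomology M n ≅ S.cohomology M n) :=
  ⟨((preadditiveCoyoneda.obj (op M)).mapHomotopyEquiv e).toHomologyIso n⟩

lemma Resolution.nonempty_cohomology_iso {M : C} (R S : ξ.Resolution M)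
    (h : ∀ m n, HomFromExact (R.complex.X m) (R.g n) (R.f n) ∧
      HomFromExact (R.complex.X m) (S.g n) (S.f n) ∧
      HomFromExact (S.complex.X m) (R.g n) (R.f n) ∧
      HomFromExact (S.complex.X m) (S.g n) (S.f n)) (N : C) (n : ℕ) :
    Nonempty (R.cohomology N n ≅ S.cohomology N n) := by
  obtain ⟨e⟩ := nonempty_homotopyEquiv_of_isHomFromAcyclic R.d_comp_aug S.d_comp_aug
    (fun m => R.isHomFromAcyclic fun n => (h m n).1)
    (fun m => S.isHomFromAcyclic fun n => (h m n).2.1)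
    (fun m => R.isHomFromAcyclic fun n => (h m n).2.2.1)
    (fun m => S.isHomFromAcyclic fun n => (h m n).2.2.2)
  exact nonempty_cohomology_iso_of_homotopyEquiv e N n

lemma Coresolution.nonempty_cohomology_iso {N : C} (R S : ξ.Coresolution N)
    (h : ∀ m n, HomToExact (R.complex.X m) (R.g n) (R.f n) ∧
      HomToExact (R.complex.X m) (S.g n) (S.f n) ∧
      HomToExact (S.complex.X m) (R.g n) (R.f n) ∧
      HomToExact (S.complex.X m) (S.g n) (S.f n)) (M : C) (n : ℕ) :
    Nonempty (R.cohomology M n ≅ S.cohomology M n) := by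
  obtain ⟨e⟩ := nonempty_homotopyEquiv_of_isHomToAcyclic R.coaug_comp_d S.coaug_comp_d
    (fun m => R.isHomToAcyclic fun n => (h m n).1)
    (fun m => S.isHomToAcyclic fun n => (h m n).2.1)
    (fun m => R.isHomToAcyclic fun n => (h m n).2.2.1)
    (fun m => S.isHomToAcyclic fun n => (h m n).2.2.2)
  exact nonempty_cohomology_iso_of_homotopyEquiv e M n

lemma Resolution.IsProj.nonempty_cohomology_iso {M : C} {R S : ξ.Resolution M}
    (hR : R.IsProj) (hS : S.IsProj) (N : C) (n : ℕ) :
    Nonempty (R.cohomology N n ≅ S.cohomology N n) :=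
  Resolution.nonempty_cohomology_iso R S (fun m n => ⟨hR m _ _ _ (R.mem n), hR m _ _ _ (S.mem n),
    hS m _ _ _ (R.mem n), hS m _ _ _ (S.mem n)⟩) N n

lemma Resolution.IsGProj.nonempty_cohomology_iso {M : C} {R S : ξ.Resolution M}
    (hR : R.IsGProj) (hS : S.IsGProj) (N : C) (n : ℕ) :
    Nonempty (R.cohomology N n ≅ S.cohomology N n) :=
  Resolution.nonempty_cohomology_iso R S (fun m n => ⟨(hR n).2 _ (hR m).1, (hS n).2 _ (hR m).1,
    (hR n).2 _ (hS m).1, (hS n).2 _ (hS m).1⟩) N n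

lemma Coresolution.IsInj.nonempty_cohomology_iso {N : C} {R S : ξ.Coresolution N}
    (hR : R.IsInj) (hS : S.IsInj) (M : C) (n : ℕ) :
    Nonempty (R.cohomology M n ≅ S.cohomology M n) :=
  Coresolution.nonempty_cohomology_iso R S (fun m n => ⟨hR m _ _ _ (R.mem n),
    hR m _ _ _ (S.mem n), hS m _ _ _ (R.mem n), hS m _ _ _ (S.mem n)⟩) M n

lemma Coresolution.IsGInj.nonempty_cohomology_iso {N : C} {R S : ξ.Coresolution N}
    (hR : R.IsGInj) (hS : S.IsGInj) (M : C) (n : ℕ) :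
    Nonempty (R.cohomology M n ≅ S.cohomology M n) :=
  Coresolution.nonempty_cohomology_iso R S (fun m n => ⟨(hR n).2 _ (hR m).1, (hS n).2 _ (hR m).1,
    (hR n).2 _ (hS m).1, (hS n).2 _ (hS m).1⟩) M n

end Extriangulation.ProperClass

/-! ### Homology and exactness in abelian categories -/

section Homology

variable {𝒜 : Type u} [Category.{v} 𝒜] [Abelian 𝒜]

/-- The homology of `X₁ ⟶ X₂ ⟶ X₃` is the cokernel of `X₁ ⟶ Z`, where `Z` is the kernel of
`X₂ ⟶ X₃`. -/
lemma CategoryTheory.ShortComplex.nonempty_homology_iso_of_exact (S : ShortComplex 𝒜) {Z H : 𝒜}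
    (i : Z ⟶ S.X₂) (hmono : Mono i) (wi : i ≫ S.g = 0) (hi : (ShortComplex.mk i S.g wi).Exact)
    (f' : S.X₁ ⟶ Z) (hf : f' ≫ i = S.f) (π : Z ⟶ H) (hepi : Epi π) (wπ : f' ≫ π = 0)
    (hπ : (ShortComplex.mk f' π wπ).Exact) : Nonempty (S.homology ≅ H) := by
  have hker : IsLimit (KernelFork.ofι i wi) := by
    have : Mono (ShortComplex.mk i S.g wi).f := hmono
    exact hi.fIsKernel
  have hcoker : IsColimit (CokernelCofork.ofπ π wπ) := by
    have : Epi (ShortComplex.mk f' π wπ).g := hepi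
    exact hπ.gIsCokernel
  have hf' : f' = hker.lift (KernelFork.ofι _ S.zero) := by
    rw [← cancel_mono i, hf]
    exact (hker.fac (KernelFork.ofι _ S.zero) WalkingParallelPair.zero).symm
  subst hf'
  let d : S.LeftHomologyData := ⟨Z, H, i, π, wi, hker, wπ, hcoker⟩
  exact ⟨d.homologyIso⟩

/-- Lets a differential `p k ≫ i (k + 1)` with `i (k + 1)` mono inherit the kernel of `p k`. -/
lemma CategoryTheory.ShortComplex.Exact.comp_mono {X Y Z T : 𝒜} {f : X ⟶ Y} {g : Y ⟶ Z}
    {w : f ≫ g = 0} (h : (ShortComplex.mk f g w).Exact) (s : Z ⟶ T) [Mono s] :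
    (ShortComplex.mk f (g ≫ s) (by simp [reassoc_of% w])).Exact := by
  let φ : ShortComplex.mk f g w ⟶ ShortComplex.mk f (g ≫ s) (by simp [reassoc_of% w]) :=
    { τ₁ := 𝟙 _, τ₂ := 𝟙 _, τ₃ := s }
  have : Epi φ.τ₁ := by dsimp [φ]; infer_instance
  have : IsIso φ.τ₂ := by dsimp [φ]; infer_instance
  have : Mono φ.τ₃ := by dsimp [φ]; infer_instance
  exact (ShortComplex.exact_iff_of_epi_of_isIso_of_mono φ).1 h

lemma CategoryTheory.ShortComplex.Exact.conj_middle {X Y Y' Z : 𝒜} {f : X ⟶ Y} {g : Y ⟶ Z}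
    {w : f ≫ g = 0} (h : (ShortComplex.mk f g w).Exact) (e : Y' ≅ Y) :
    ∃ w' : (f ≫ e.inv) ≫ (e.hom ≫ g) = 0, (ShortComplex.mk _ _ w').Exact :=
  ⟨by simp [w], ShortComplex.exact_of_iso
    (ShortComplex.isoMk (S₁ := .mk f g w)
      (S₂ := .mk (f ≫ e.inv) (e.hom ≫ g) (by simp [w])) (Iso.refl _) e.symm (Iso.refl _) (by simp) (by simp)) h⟩

lemma CategoryTheory.ShortComplex.Exact.iso_comp {X X' Y Z : 𝒜} {f : X ⟶ Y} {g : Y ⟶ Z}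
    {w : f ≫ g = 0} (h : (ShortComplex.mk f g w).Exact) (e : X' ≅ X) :
    ∃ w' : (e.hom ≫ f) ≫ g = 0, (ShortComplex.mk _ _ w').Exact :=
  ⟨by simp [w], ShortComplex.exact_of_iso
    (ShortComplex.isoMk (S₁ := .mk f g w)
      (S₂ := .mk (e.hom ≫ f) g (by simp [w])) e.symm (Iso.refl _) (Iso.refl _) (by simp) (by simp)) h⟩

end Homology

/-! ### The complex `C(X, N)` as a functor of `N` -/

section HomComplex

variable {C : Type u} [Category.{v} C] [Preadditive C]

/-- The functor sending `N` to the cochain complex `C(X, N)`. -/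
noncomputable def homComplex (X : ChainComplex C ℕ) :
    C ⥤ HomologicalComplex AddCommGrpCat.{v} (ComplexShape.down ℕ).symm where
  obj N := ((preadditiveYoneda.obj N).mapHomologicalComplex _).obj X.op
  map φ := (NatTrans.mapHomologicalComplex (preadditiveYoneda.map φ) _).app X.op

instance (X : ChainComplex C ℕ) : (homComplex X).Additive where
  map_add {N N' φ ψ} := by
    ext i f
    exact Preadditive.comp_add _ _ _ f φ ψ

variable (X : ChainComplex C ℕ) {N₁ N₂ N₃ : C} {x : N₁ ⟶ N₂} {y : N₂ ⟶ N₃}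

lemma homComplex_shortExact (hxy : x ≫ y = 0) (h : ∀ i, HomFromExact (X.X i) x y) :
    ((ShortComplex.mk x y hxy).map (homComplex X)).ShortExact := by
  refine HomologicalComplex.shortExact_of_degreewise_shortExact _ (fun i => ?_)
  have : Mono ((((ShortComplex.mk x y hxy).map (homComplex X)).map
      (HomologicalComplex.eval _ _ i)).f) := by
    rw [AddCommGrpCat.mono_iff_injective]
    exact (h i).1
  have : Epi ((((ShortComplex.mk x y hxy).map (homComplex X)).map
      (HomologicalComplex.eval _ _ i)).g) := by
    rw [AddCommGrpCat.epi_iff_surjective]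
    exact (h i).2.2
  refine ⟨?_⟩
  rw [ShortComplex.ab_exact_iff_function_exact]
  exact (h i).2.1

lemma homComplex_isZero_homology (Q : C) (n : ℕ)
    (h : ∀ f : X.X (n + 1) ⟶ Q, X.d (n + 2) (n + 1) ≫ f = 0 →
      ∃ l : X.X n ⟶ Q, X.d (n + 1) n ≫ l = f) :
    IsZero (((homComplex X).obj Q).homology (n + 1)) := by
  rw [← HomologicalComplex.exactAt_iff_isZero_homology,
    HomologicalComplex.exactAt_iff' _ n (n + 1) (n + 2) (ComplexShape.prev_eq' _ rfl)
      (ComplexShape.next_eq' _ rfl), ShortComplex.ab_exact_iff]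
  exact h

variable {X} {M : C} (ε : X.X 0 ⟶ M) (hε : X.d 1 0 ≫ ε = 0)

/-- The map `C(M, Q) ⟶ C(X 0, Q)` induced by an augmentation `X 0 ⟶ M`. -/
noncomputable def homComplexAugX (Q : C) :
    (preadditiveCoyoneda.obj (op M)).obj Q ⟶ ((homComplex X).obj Q).X 0 :=
  (preadditiveYoneda.obj Q).map ε.op

lemma homComplexAugX_comp_d (hε : X.d 1 0 ≫ ε = 0) (Q : C) :
    homComplexAugX ε Q ≫ ((homComplex X).obj Q).d 0 1 = 0 := by
  have h (f : M ⟶ Q) : X.d 1 0 ≫ ε ≫ f = 0 := by rw [← Category.assoc, hε, zero_comp]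
  ext f
  exact h f

/-- The map `C(M, Q) ⟶ H⁰(C(X, Q))` induced by an augmentation `X 0 ⟶ M`. -/
noncomputable def homComplexAug (Q : C) :
    (preadditiveCoyoneda.obj (op M)).obj Q ⟶ ((homComplex X).obj Q).homology 0 :=
  HomologicalComplex.liftCycles ((homComplex X).obj Q) (homComplexAugX ε Q) 1
    (ComplexShape.next_eq' _ rfl) (homComplexAugX_comp_d ε hε Q) ≫
    ((homComplex X).obj Q).homologyπ 0

lemma homComplexAug_naturality {Q Q' : C} (φ : Q ⟶ Q') :
    homComplexAug ε hε Q ≫ HomologicalComplex.homologyMap ((homComplex X).map φ) 0 =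
      (preadditiveCoyoneda.obj (op M)).map φ ≫ homComplexAug ε hε Q' := by
  rw [homComplexAug, homComplexAug, Category.assoc, HomologicalComplex.homologyπ_naturality,
    ← Category.assoc, ← Category.assoc]
  congr 1
  rw [← cancel_mono (HomologicalComplex.iCycles _ _), Category.assoc,
    HomologicalComplex.cyclesMap_i, HomologicalComplex.liftCycles_i_assoc, Category.assoc,
    HomologicalComplex.liftCycles_i]
  ext f
  exact Category.assoc _ _ _

/-- No differential enters degree 0, so `H⁰` is the kernel of `d 0 1`, which the hypotheses identify
with `C(M, Q)`. -/
lemma isIso_homComplexAug {Q : C} (hinj : ∀ f : M ⟶ Q, ε ≫ f = 0 → f = 0)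
    (hex : ∀ f : X.X 0 ⟶ Q, X.d 1 0 ≫ f = 0 → ∃ l : M ⟶ Q, ε ≫ l = f) :
    IsIso (homComplexAug ε hε Q) := by
  have := ((homComplex X).obj Q).isIso_homologyπ _ 0 rfl
    (HomologicalComplex.shape _ _ _ (Nat.succ_ne_zero _))
  let k := homComplexAugX ε Q
  have hk := homComplexAugX_comp_d ε hε Q
  have hmono : Mono (ShortComplex.mk k _ hk).f := by
    rw [AddCommGrpCat.mono_iff_injective, injective_iff_map_eq_zero]
    exact hinj
  have hexact : (ShortComplex.mk k _ hk).Exact := by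
    rw [ShortComplex.ab_exact_iff]
    exact hex
  have hiso : IsIso (((homComplex X).obj Q).liftCycles k 1 (ComplexShape.next_eq' _ rfl) hk) := by
    let e := hexact.fIsKernel.conePointUniqueUpToIso
      (((homComplex X).obj Q).cyclesIsKernel 0 1 (ComplexShape.next_eq' _ rfl))
    have : ((homComplex X).obj Q).liftCycles k 1 (ComplexShape.next_eq' _ rfl) hk = e.hom := by
      rw [← cancel_mono (((homComplex X).obj Q).iCycles 0), HomologicalComplex.liftCycles_i]
      exact (hexact.fIsKernel.conePointUniqueUpToIso_hom_comp
        (((homComplex X).obj Q).cyclesIsKernel 0 1 (ComplexShape.next_eq' _ rfl))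
        WalkingParallelPair.zero).symm
    rw [this]
    infer_instance
  unfold homComplexAug
  infer_instance

end HomComplex

/-! ### Balance of resolutions and coresolutions -/

namespace Extriangulation.ProperClass

variable {C : Type u} [Category.{v} C] [Preadditive C] [HasZeroObject C] [HasBinaryBiproducts C]
  {E : Extriangulation.{w} C} {ξ : E.ProperClass}

section Balance

variable {M N : C} (P : ξ.Resolution M) (I : ξ.Coresolution N)

/-- A cocycle on `X (n + 1)` vanishes on `K (n + 2)`, hence descends to `K (n + 1)`, and from there
extends to `X n`. -/
lemma Resolution.isZero_homology_homComplex {Q : C} (h : ∀ i, HomToExact Q (P.g i) (P.f i))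
    (n : ℕ) : IsZero (((homComplex P.complex).obj Q).homology (n + 1)) := by
  refine homComplex_isZero_homology _ Q n (fun f hf => ?_)
  have hf' : P.g (n + 1) ≫ f = 0 := (h (n + 2)).eq_zero (by
    rw [← Category.assoc, ← P.d_eq]
    exact hf)
  obtain ⟨a, rfl⟩ := (ξ.realizes _ _ _ (P.mem (n + 1))).exists_desc f hf'
  obtain ⟨l, rfl⟩ := (h n).exists_extension a
  exact ⟨l, by rw [P.d_eq, Category.assoc]⟩

lemma Resolution.isIso_homComplexAug {Q : C} (h : ∀ i, HomToExact Q (P.g i) (P.f i)) :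
    IsIso (homComplexAug P.aug P.d_comp_aug Q) := by
  refine _root_.isIso_homComplexAug P.aug P.d_comp_aug (fun f hf => ?_) (fun f hf => ?_)
  · have : eqToHom P.K_zero ≫ f = 0 := (h 0).eq_zero (by simpa [aug] using hf)
    simpa using congr(eqToHom P.K_zero.symm ≫ $this)
  · have hf' : P.g 0 ≫ f = 0 := (h 1).eq_zero (by
      rw [← Category.assoc, ← P.d_eq]
      exact hf)
    obtain ⟨a, rfl⟩ := (ξ.realizes _ _ _ (P.mem 0)).exists_desc f hf'
    exact ⟨eqToHom P.K_zero.symm ≫ a, by simp [aug]⟩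

lemma Coresolution.g_comp_f (k : ℕ) : I.g k ≫ I.f k = 0 :=
  (ξ.realizes _ _ _ (I.mem k)).comp_eq_zero

variable {P I} (hPI : ∀ i k, HomFromExact (P.complex.X i) (I.g k) (I.f k))
  (hIP : ∀ k i, HomToExact (I.complex.X k) (P.g i) (P.f i))
include hPI hIP

/-- Dimension shifting along a coresolution, down to degree `0`. -/
lemma exists_kernel_data : ∃ (i : ∀ k, ((homComplex P.complex).obj (I.K k)).homology 0 ⟶
      (preadditiveCoyoneda.obj (op M)).obj (I.complex.X k))
    (p : ∀ k, (preadditiveCoyoneda.obj (op M)).obj (I.complex.X k) ⟶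
      ((homComplex P.complex).obj (I.K (k + 1))).homology 0)
    (q : ∀ k, ((homComplex P.complex).obj (I.K (k + 1))).homology 0 ⟶
      ((homComplex P.complex).obj (I.K k)).homology 1),
    (∀ k, Mono (i k)) ∧ (∀ k, Epi (q k)) ∧
    (∀ k, ∃ w : i k ≫ p k = 0, (ShortComplex.mk _ _ w).Exact) ∧
    (∀ k, ∃ w : p k ≫ q k = 0, (ShortComplex.mk _ _ w).Exact) ∧
    ∀ k, p k ≫ i (k + 1) =
      (preadditiveCoyoneda.obj (op M)).map (I.complex.d k (k + 1)) := by
  have := fun k => P.isIso_homComplexAug (hIP k)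
  have hS := fun k => homComplex_shortExact P.complex (I.g_comp_f k) (fun i => hPI i k)
  let e := fun k => asIso (homComplexAug P.aug P.d_comp_aug (I.complex.X k))
  have hrel : (ComplexShape.down ℕ).symm.Rel 0 1 := rfl
  let g := fun k => HomologicalComplex.homologyMap ((homComplex P.complex).map (I.g k)) 0
  let f := fun k => HomologicalComplex.homologyMap ((homComplex P.complex).map (I.f k)) 0
  have hg : ∀ k, Mono (g k) := fun k => by
    have : Mono (((homComplex P.complex).map (I.g k))) := (hS k).mono_f
    -- With no differential into degree 0, `H⁰` preserves monomorphisms.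
    exact HomologicalComplex.mono_homologyMap_of_mono_of_not_rel _ _
      (fun j => Nat.succ_ne_zero j)
  -- The start of the long exact sequence of `C(P, K k) ⟶ C(P, I k) ⟶ C(P, K (k + 1))`, with
  -- `H⁰(C(P, I k))` replaced by `C(M, I k)`; `q k` is epi because `H¹(C(P, I k)) = 0`.
  refine ⟨fun k => g k ≫ (e k).inv, fun k => (e k).hom ≫ f k, fun k => (hS k).δ 0 1 hrel,
    fun k => ?_, fun k => ?_, fun k => ?_, fun k => ?_, fun k => ?_⟩
  · infer_instance
  · exact (hS k).epi_δ 0 1 hrel (P.isZero_homology_homComplex (hIP k) 0)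
  · exact ((hS k).homology_exact₂ 0).conj_middle (e k)
  · exact ((hS k).homology_exact₃ 0 1 hrel).iso_comp (e k)
  · have := homComplexAug_naturality P.aug P.d_comp_aug (I.complex.d k (k + 1))
    have hd : f k ≫ g (k + 1) =
        HomologicalComplex.homologyMap ((homComplex P.complex).map (I.complex.d k (k + 1))) 0 := by
      rw [← HomologicalComplex.homologyMap_comp, ← Functor.map_comp, I.d_eq]
    rw [Category.assoc, reassoc_of% hd, ← Category.assoc, Iso.comp_inv_eq]
    exact this

lemma Resolution.nonempty_cohomology_zero_iso :
    Nonempty (P.cohomology N 0 ≅ I.cohomology M 0) := by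
  obtain ⟨i, p, q, hi, hq, hip, hpq, hpi⟩ := exists_kernel_data hPI hIP
  obtain ⟨w, hw⟩ := hip 0
  have := hi 1
  let K := ((preadditiveCoyoneda.obj (op M)).mapHomologicalComplex _).obj I.complex
  -- Here `prev 0` is a default value: nothing precedes degree 0, so `S.f = 0`.
  let S := K.sc' ((ComplexShape.up ℕ).prev 0) 0 1
  have hSf : S.f = 0 := K.shape _ _ (Nat.succ_ne_zero _)
  have hSg : S.g = p 0 ≫ i 1 := (hpi 0).symm
  have hexact := hw.comp_mono (i 1)
  have hid : (ShortComplex.mk (0 : S.X₁ ⟶ _)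
      (𝟙 (((homComplex P.complex).obj (I.K 0)).homology 0)) (by simp)).Exact :=
    (ShortComplex.exact_iff_mono _ rfl).2 (by dsimp; infer_instance)
  simp only [← hSg] at hexact
  obtain ⟨e⟩ := S.nonempty_homology_iso_of_exact (i 0) (hi 0) _ hexact 0
    (zero_comp.trans hSf.symm) (𝟙 _) inferInstance _ hid
  have eN : ((homComplex P.complex).obj N).homology 0 ≅
    ((homComplex P.complex).obj (I.K 0)).homology 0 := eqToIso (by rw [I.K_zero])
  exact ⟨eN ≪≫ e.symm ≪≫ (K.homologyIsoSc' _ 0 1 rfl (ComplexShape.next_eq' _ rfl)).symm⟩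

/-- For `n = 0`: `i (k + 1)` is the kernel of the differential leaving `C(M, I (k + 1))`, the one
entering it is `p k ≫ i (k + 1)`, and `q k` is the cokernel of `p k`. Higher degrees shift by
connecting isomorphisms, as `C(P, I k)` has no positive cohomology. -/
lemma nonempty_homology_iso_of_add_eq (n k m : ℕ) (h : n + k = m) :
    Nonempty (((homComplex P.complex).obj (I.K k)).homology (n + 1) ≅ I.cohomology M (m + 1)) := by
  induction n generalizing k with
  | zero =>
    obtain rfl : k = m := by simpa using h
    obtain ⟨i, p, q, hi, hq, hip, hpq, hpi⟩ := exists_kernel_data hPI hIP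
    have := hi (k + 2)
    let K := ((preadditiveCoyoneda.obj (op M)).mapHomologicalComplex _).obj I.complex
    let S := K.sc' k (k + 1) (k + 2)
    have hSg : S.g = p (k + 1) ≫ i (k + 2) := (hpi (k + 1)).symm
    obtain ⟨w, hw⟩ := hip (k + 1)
    obtain ⟨w', hw'⟩ := hpq k
    have hexact := hw.comp_mono (i (k + 2))
    simp only [← hSg] at hexact
    obtain ⟨e⟩ := S.nonempty_homology_iso_of_exact (i (k + 1)) (hi _) _ hexact (p k)
      (hpi k) (q k) (hq k) w' hw'
    exact ⟨e.symm ≪≫ (K.homologyIsoSc' k (k + 1) (k + 2) (ComplexShape.prev_eq' _ rfl)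
      (ComplexShape.next_eq' _ rfl)).symm⟩
  | succ n ih =>
    obtain ⟨e⟩ := ih (k + 1) (by omega)
    have hS := homComplex_shortExact P.complex (I.g_comp_f k) (fun i => hPI i k)
    exact ⟨(hS.δIso (n + 1) (n + 2) rfl (P.isZero_homology_homComplex (hIP k) n)
      (P.isZero_homology_homComplex (hIP k) (n + 1))).symm ≪≫ e⟩

/-- If `C(P, -)` is exact on the coresolution `I` and `C(-, I)` is exact on the resolution `P`,
then `C(P, N)` and `C(M, I)` have the same cohomology. -/
lemma Resolution.nonempty_cohomology_iso_coresolution (n : ℕ) :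
    Nonempty (P.cohomology N n ≅ I.cohomology M n) := by
  cases n with
  | zero => exact Resolution.nonempty_cohomology_zero_iso hPI hIP
  | succ n =>
    obtain ⟨e⟩ := nonempty_homology_iso_of_add_eq hPI hIP n 0 n rfl
    have eN : ((homComplex P.complex).obj N).homology (n + 1) ≅
      ((homComplex P.complex).obj (I.K 0)).homology (n + 1) := eqToIso (by rw [I.K_zero])
    exact ⟨eN ≪≫ e⟩

end Balance

lemma Resolution.IsProj.nonempty_cohomology_iso_coresolution {M N : C} {P : ξ.Resolution M}
    {I : ξ.Coresolution N} (hP : P.IsProj) (hI : I.IsInj) (n : ℕ) :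
    Nonempty (P.cohomology N n ≅ I.cohomology M n) :=
  Resolution.nonempty_cohomology_iso_coresolution (fun i k => hP i _ _ _ (I.mem k))
    (fun k i => hI k _ _ _ (P.mem i)) n

end Extriangulation.ProperClass

theorem mainTheorem3 {C : Type u} [Category.{v} C] [Preadditive C] [HasZeroObject C]
    [HasBinaryBiproducts C] (E : Extriangulation.{w} C) (hE : E.WIC) (ξ : E.ProperClass)
    (hP : ξ.EnoughProj) (hI : ξ.EnoughInj) (M N : C) :
    (∃ P : ξ.Resolution M, P.IsProj) ∧ (∃ I : ξ.Coresolution N, I.IsInj) ∧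
    (ξ.FiniteProjDim M →
      (∃ G : ξ.Resolution M, G.IsGProj) ∧
      ∀ G : ξ.Resolution M, G.IsGProj → ∀ n : ℕ,
        (∀ P : ξ.Resolution M, P.IsProj →
          Nonempty (G.cohomology N n ≅ P.cohomology N n)) ∧
        (∀ I : ξ.Coresolution N, I.IsInj →
          Nonempty (G.cohomology N n ≅ I.cohomology M n))) ∧
    (ξ.FiniteInjDim N →
      (∃ J : ξ.Coresolution N, J.IsGInj) ∧
      ∀ J : ξ.Coresolution N, J.IsGInj → ∀ n : ℕ,
        (∀ P : ξ.Resolution M, P.IsProj →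
          Nonempty (J.cohomology M n ≅ P.cohomology N n)) ∧
        (∀ I : ξ.Coresolution N, I.IsInj →
          Nonempty (J.cohomology M n ≅ I.cohomology M n))) := by
  refine ⟨hP.exists_resolution M, hI.exists_coresolution N, fun hM => ?_, fun hN => ?_⟩
  -- Finite dimension enters only here: `F` is a resolution of both kinds.
  · obtain ⟨F, hF, hFG⟩ := hM.exists_resolution
    refine ⟨⟨F, hFG⟩, fun G hG n => ?_⟩
    obtain ⟨e⟩ := hG.nonempty_cohomology_iso hFG N n
    refine ⟨fun P hP => ?_, fun I hI => ?_⟩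
    · obtain ⟨e'⟩ := hF.nonempty_cohomology_iso hP N n
      exact ⟨e ≪≫ e'⟩
    · obtain ⟨e'⟩ := hF.nonempty_cohomology_iso_coresolution hI n
      exact ⟨e ≪≫ e'⟩
  · obtain ⟨F, hF, hFG⟩ := hN.exists_coresolution
    refine ⟨⟨F, hFG⟩, fun J hJ n => ?_⟩
    obtain ⟨e⟩ := hJ.nonempty_cohomology_iso hFG M n
    refine ⟨fun P hP => ?_, fun I hI => ?_⟩
    · obtain ⟨e'⟩ := hP.nonempty_cohomology_iso_coresolution hF n
      exact ⟨e ≪≫ e'.symm⟩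
    · obtain ⟨e'⟩ := hF.nonempty_cohomology_iso hI M n
      exact ⟨e ≪≫ e'⟩
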